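/- Fix integers $n\ge 1$ and $k\ge 1$. Let $Mu(x)=\sup_{Q\ni x}\frac1{|Q|}\int_Q|u(y)|\,dy$ be the Hardy–Littlewood maximal operator over cubes $Q\subseteq\mathbb R^n$ with sides parallel to the axes. Let $A_1$ be the class of a.e. positive, locally integrable functions $u$ on $\mathbb R^n$ such that $Mu\le C\,u$ a.e. for some finite constant $C$; the infimum of these constants is denoted by $\|u\|_{A_1}$. Write $u(F)=\int_F u$, and let $\|f\|_{L^1(u)}=\int_{\mathbb R^n}|f|\,u\,dx$ and $\|g\|_{L^{1,\infty}(u)}=\sup_{y>0}y\,u(\{|g|>y\})$. For a measurable function $f$ on $\mathbb R^n$ let $f^*(t)=\inf\{s>0:|\{|f|>s\}|\le t\}\in[0,\infty]$, $t>0$, be its decreasing rearrangement with respect to Lebesgue measure. Let $T$ be an operator that is defined on the vector space $\mathcal D=\bigcup_{u\in A_1}L^1(u)$ of real- or complex-valued measurable functions and takes values in the measurable functions. Suppose that $T$ is sublinear, that is, $|T(f+g)|\le|Tf|+|Tg|$ and $|T(cf)|=|c|\,|Tf|$ a.e. for all $f,g\in\mathcal D$ and all scalars $c$. Suppose also that there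 is a constant $C\ge 0$ such that, for every $u\in A_1$, $$\|Tf\|_{L^{1,\infty}(u)}\le C\,\|u\|_{A_1}^k\,\|f\|_{L^1(u)}\qquad\text{for all } f\in L^1(u).$$ Then there is a finite constant $K$, depending only on $n$, $k$ and $C$, such that, for every $t>0$ and every $f\in\mathcal D$, $$(Tf)^*(t)\le K\left(\frac1t\int_0^t f^*(s)\,ds+\int_t^\infty\Big(1+\log\frac st\Big)^{k-1}f^*(s)\,\frac{ds}{s}\right),$$ where the right-hand side may be infinite. -/

import Mathlib

open MeasureTheory Set
open scoped NNReal ENNReal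

noncomputable section

namespace WeakRearr

/-- The closed cube in `ℝⁿ` with sides parallel to the axes, lower corner `a`, side length `h`. -/
def cube {n : ℕ} (a : Fin n → ℝ) (h : ℝ) : Set (Fin n → ℝ) :=
  Set.Icc a (fun i => a i + h)

/-- The (uncentred) Hardy-Littlewood maximal function over cubes, with values in `[0, ∞]`:
`Mu(x) = sup_{Q ∋ x} |Q|⁻¹ ∫_Q |u|`. -/
def hlMaximal {n : ℕ} (u : (Fin n → ℝ) → ℝ) (x : Fin n → ℝ) : ℝ≥0∞ :=
  ⨆ (a : Fin n → ℝ) (h : ℝ) (_ : 0 < h) (_ : x ∈ cube a h),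
    (volume (cube a h))⁻¹ * ∫⁻ y in cube a h, ‖u y‖ₑ

/-- `Mu ≤ C u` almost everywhere. -/
def A1Bound {n : ℕ} (u : (Fin n → ℝ) → ℝ) (C : ℝ≥0∞) : Prop :=
  ∀ᵐ x, hlMaximal u x ≤ C * ENNReal.ofReal (u x)

/-- The Muckenhoupt class `A₁`: weights (a.e. positive, locally integrable functions) with
`Mu ≤ C u` a.e. for some finite constant `C`. -/
structure IsA1 {n : ℕ} (u : (Fin n → ℝ) → ℝ) : Prop where
  pos : ∀ᵐ x, 0 < u x
  locallyIntegrable : LocallyIntegrable u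
  exists_bound : ∃ C : ℝ≥0, A1Bound u C

/-- `‖u‖_{A₁}`, the infimum of the constants `C` with `Mu ≤ C u` a.e. -/
def a1Norm {n : ℕ} (u : (Fin n → ℝ) → ℝ) : ℝ≥0∞ :=
  sInf {C : ℝ≥0∞ | A1Bound u C}

/-- The measure `u(x) dx`. -/
def weightMeasure {n : ℕ} (u : (Fin n → ℝ) → ℝ) : Measure (Fin n → ℝ) :=
  volume.withDensity (fun x => ENNReal.ofReal (u x))

/-- The quasinorm of `L^{1,∞}(μ)`: `sup_{y > 0} y μ{|g| > y}`. -/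
def weakL1Norm {α 𝕜 : Type*} [MeasurableSpace α] [RCLike 𝕜] (g : α → 𝕜) (μ : Measure α) : ℝ≥0∞ :=
  ⨆ (y : ℝ) (_ : 0 < y), ENNReal.ofReal y * μ {x | y < ‖g x‖}

/-- `T` maps `L¹(μ)` into `L^{1,∞}(μ)` with constant at most `A`. -/
def BoundedL1WeakL1 {α 𝕜 : Type*} [MeasurableSpace α] [RCLike 𝕜]
    (T : (α → 𝕜) → (α → 𝕜)) (μ : Measure α) (A : ℝ≥0∞) : Prop :=
  ∀ f : α → 𝕜, MemLp f 1 μ →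
    AEStronglyMeasurable (T f) μ ∧ weakL1Norm (T f) μ ≤ A * eLpNorm f 1 μ

/-- The union of the spaces `L¹(u)`, `u ∈ A₁`. This is the common domain of the operators that act
on `L¹(u)` for every `u ∈ A₁`. It is a vector space, since the minimum of two `A₁` weights is an
`A₁` weight. -/
def a1Domain (n : ℕ) (𝕜 : Type*) [RCLike 𝕜] : Set ((Fin n → ℝ) → 𝕜) :=
  {f | ∃ u : (Fin n → ℝ) → ℝ, IsA1 u ∧ MemLp f 1 (weightMeasure u)}

/-- `T` is sublinear on `D`: `|T(f + g)| ≤ |Tf| + |Tg|` and `|T(c f)| = |c| |Tf|` a.e. -/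
def IsSublinearOn {α 𝕜 : Type*} [MeasureSpace α] [RCLike 𝕜]
    (D : Set (α → 𝕜)) (T : (α → 𝕜) → (α → 𝕜)) : Prop :=
  (∀ f ∈ D, ∀ g ∈ D, ∀ᵐ x, ‖T (f + g) x‖ ≤ ‖T f x‖ + ‖T g x‖) ∧
  (∀ c : 𝕜, ∀ f ∈ D, ∀ᵐ x, ‖T (c • f) x‖ = ‖c‖ * ‖T f x‖)

/-- The decreasing rearrangement with respect to Lebesgue measure, with values in `[0, ∞]`:
`f^*(t) = inf {s > 0 : |{|f| > s}| ≤ t}`, where `inf ∅ = ∞`. -/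
def rearr {α 𝕜 : Type*} [MeasureSpace α] [RCLike 𝕜] (f : α → 𝕜) (t : ℝ) : ℝ≥0∞ :=
  ⨅ (s : ℝ) (_ : 0 < s) (_ : volume {x | s < ‖f x‖} ≤ ENNReal.ofReal t), ENNReal.ofReal s

end WeakRearr

end

/-! The weak type hypothesis is tested on weights built from the very level set to be estimated. Let
h be bounded by l and supported on a set of measure at most s, and suppose |Th| > y on a set F of
finite measure with |F| > τ, where τ ≤ s. The maximal operator is bounded on L^{1+δ} with constant
O(1/δ), so the Rubio de Francia series started at 1_F gives an A₁ weight u with u ≥ 1 a.e. on F,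
norm O(1/δ) and u(S) ≤ 2|F|^{1/(1+δ)}|S|^{δ/(1+δ)} (`exists_isA1_ge_one_on`). With δ = 1/(1 +
log(s/τ)) the support of h has u-measure O(|F|), and the weighted bound forces y ≲ (1 + log(s/τ))^k
l (`volume_lt_norm_apply_le`).

A general f is cut at the levels f^*(t_j), t_j = t·exp(2^j - 1). The part above f^*(t) is treated
with the constant weight. The piece between the levels j and j + 1 is bounded by f^*(t_j) and
supported on a set of measure at most t_{j+1}; with an exceptional set of measure t/2^{j+2} it
contributes O(2^{jk} f^*(t_j)). The sum over j ≥ 1 is dominated by the logarithmic integral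
(`sum_rearr_expPoint_le`), and the term j = 0 by the average. Dyadic points t_j would lose one power
of the logarithm; points at which 1 + log(s/t) doubles do not.

Sublinearity only covers finite sums. The remainder below f^*(t_N) tends to zero in L¹(u) for any A₁
weight u with f ∈ L¹(u), so its image is small in u-measure, hence locally in Lebesgue measure
(`IsA1.tendsto_volume_inter`). The pieces are assembled in `rearr_apply_le_of_levels`. -/

noncomputable section

namespace WeakRearr

/-! ### Cubes and the maximal function. -/

/-- The maximal function over cubes of a `[0, ∞]`-valued function. -/
def cubeMaximal {n : ℕ} (v : (Fin n → ℝ) → ℝ≥0∞) (x : Fin n → ℝ) : ℝ≥0∞ :=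
  ⨆ (a : Fin n → ℝ) (h : ℝ) (_ : 0 < h) (_ : x ∈ cube a h),
    (volume (cube a h))⁻¹ * ∫⁻ y in cube a h, v y

lemma volume_cube {n : ℕ} (a : Fin n → ℝ) (h : ℝ) :
    volume (cube a h) = ENNReal.ofReal h ^ n := by
  simp [cube, Real.volume_Icc_pi]

lemma volume_cube_ne_zero {n : ℕ} (a : Fin n → ℝ) {h : ℝ} (hh : 0 < h) :
    volume (cube a h) ≠ 0 := by
  rw [volume_cube]
  exact pow_ne_zero _ (by simpa using hh)

lemma volume_cube_ne_top {n : ℕ} (a : Fin n → ℝ) (h : ℝ) : volume (cube a h) ≠ ∞ := by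
  rw [volume_cube]
  exact ENNReal.pow_ne_top ENNReal.ofReal_ne_top

lemma measurableSet_cube {n : ℕ} (a : Fin n → ℝ) (h : ℝ) : MeasurableSet (cube a h) :=
  measurableSet_Icc

lemma cube_eq_closedBall {n : ℕ} (a : Fin n → ℝ) {h : ℝ} (hh : 0 ≤ h) :
    cube a h = Metric.closedBall (fun i => a i + h / 2) (h / 2) := by
  rw [closedBall_pi _ (by positivity), cube, ← Set.pi_univ_Icc]
  congr 1
  ext i : 1
  rw [Real.closedBall_eq_Icc]
  congr 1 <;> ring

lemma lt_cubeMaximal_iff {n : ℕ} {v : (Fin n → ℝ) → ℝ≥0∞} {x : Fin n → ℝ} {y : ℝ≥0∞} :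
    y < cubeMaximal v x ↔ ∃ (a : Fin n → ℝ) (h : ℝ), 0 < h ∧ x ∈ cube a h ∧
      y < (volume (cube a h))⁻¹ * ∫⁻ z in cube a h, v z := by
  simp only [cubeMaximal, lt_iSup_iff, exists_prop]

lemma cubeMaximal_le_iff {n : ℕ} {v : (Fin n → ℝ) → ℝ≥0∞} {x : Fin n → ℝ} {y : ℝ≥0∞} :
    cubeMaximal v x ≤ y ↔ ∀ (a : Fin n → ℝ) (h : ℝ), 0 < h → x ∈ cube a h →
      (volume (cube a h))⁻¹ * ∫⁻ z in cube a h, v z ≤ y := by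
  simp only [cubeMaximal, iSup_le_iff]

lemma average_le_cubeMaximal {n : ℕ} (v : (Fin n → ℝ) → ℝ≥0∞) {x a : Fin n → ℝ} {h : ℝ}
    (hh : 0 < h) (hx : x ∈ cube a h) :
    (volume (cube a h))⁻¹ * ∫⁻ z in cube a h, v z ≤ cubeMaximal v x :=
  cubeMaximal_le_iff.1 le_rfl a h hh hx

/-- Enlarging a cube by ε on each side captures all points near x and changes the average by a
factor tending to 1. No measurability of v is needed. -/
lemma isOpen_lt_cubeMaximal {n : ℕ} (v : (Fin n → ℝ) → ℝ≥0∞) (y : ℝ≥0∞) :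
    IsOpen {x | y < cubeMaximal v x} := by
  rw [Metric.isOpen_iff]
  intro x hx
  obtain ⟨a, h, hh, hxa, hy⟩ := lt_cubeMaximal_iff.1 hx
  rw [volume_cube] at hy
  have hlim : Filter.Tendsto (fun ε : ℝ => (ENNReal.ofReal (h + 2 * ε) ^ n)⁻¹ *
      ∫⁻ z in cube a h, v z) (nhdsWithin 0 (Ioi 0))
      (nhds ((ENNReal.ofReal h ^ n)⁻¹ * ∫⁻ z in cube a h, v z)) := by
    refine ENNReal.Tendsto.mul_const ?_ (Or.inl ?_)
    · refine Filter.Tendsto.inv (ENNReal.Tendsto.pow (ENNReal.tendsto_ofReal ?_))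
      have : Continuous fun ε : ℝ => h + 2 * ε := by fun_prop
      simpa using (this.tendsto 0).mono_left nhdsWithin_le_nhds
    · exact ENNReal.inv_ne_zero.2 (ENNReal.pow_ne_top ENNReal.ofReal_ne_top)
  obtain ⟨ε, hε, hε0⟩ := ((hlim.eventually (lt_mem_nhds hy)).and self_mem_nhdsWithin).exists
  have hε0 : 0 < ε := hε0
  refine ⟨ε, hε0, fun z hz => ?_⟩
  refine lt_cubeMaximal_iff.2 ⟨fun i => a i - ε, h + 2 * ε, by positivity, ?_, ?_⟩
  · have hz' : ∀ i, |z i - x i| < ε := fun i => by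
      have := (dist_pi_lt_iff hε0).1 hz i
      rwa [Real.dist_eq] at this
    constructor
    · intro i
      have h1 := abs_lt.1 (hz' i)
      have h2 := hxa.1 i
      simp only
      linarith
    · intro i
      have h1 := abs_lt.1 (hz' i)
      have h2 := hxa.2 i
      simp only at h2 ⊢
      linarith
  · rw [volume_cube]
    refine hε.trans_le (mul_le_mul_right (lintegral_mono_set ?_) _)
    refine Icc_subset_Icc (fun i => ?_) (fun i => ?_)
    · simp only; linarith
    · simp only; linarith

lemma measurable_cubeMaximal {n : ℕ} (v : (Fin n → ℝ) → ℝ≥0∞) : Measurable (cubeMaximal v) :=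
  measurable_of_Ioi fun y => (isOpen_lt_cubeMaximal v y).measurableSet

lemma cubeMaximal_mono {n : ℕ} {v w : (Fin n → ℝ) → ℝ≥0∞} (h : v ≤ w) :
    cubeMaximal v ≤ cubeMaximal w := fun _ =>
  cubeMaximal_le_iff.2 fun _ _ hh hx => (mul_le_mul_right (lintegral_mono h) _).trans
    (average_le_cubeMaximal w hh hx)

lemma cubeMaximal_add_const_le {n : ℕ} (v : (Fin n → ℝ) → ℝ≥0∞) (c : ℝ≥0∞) (x : Fin n → ℝ) :
    cubeMaximal (fun z => v z + c) x ≤ cubeMaximal v x + c := by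
  refine cubeMaximal_le_iff.2 fun a h hh hx => ?_
  rw [lintegral_add_right _ measurable_const, setLIntegral_const, mul_add]
  refine add_le_add (average_le_cubeMaximal v hh hx) (le_of_eq ?_)
  rw [mul_comm c, ← mul_assoc, ENNReal.inv_mul_cancel (volume_cube_ne_zero a hh)
    (volume_cube_ne_top a h), one_mul]

lemma cubeMaximal_tsum_le {n : ℕ} {v : ℕ → (Fin n → ℝ) → ℝ≥0∞} (hv : ∀ j, Measurable (v j))
    (c : ℕ → ℝ≥0∞) (x : Fin n → ℝ) :
    cubeMaximal (fun z => ∑' j, c j * v j z) x ≤ ∑' j, c j * cubeMaximal (v j) x := by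
  refine cubeMaximal_le_iff.2 fun a h hh hx => ?_
  rw [lintegral_tsum fun j => ((hv j).const_mul _).aemeasurable, ← ENNReal.tsum_mul_left]
  refine ENNReal.tsum_le_tsum fun j => ?_
  rw [lintegral_const_mul _ (hv j), mul_left_comm]
  exact mul_le_mul_right (average_le_cubeMaximal (v j) hh hx) _

/-! ### Weak and strong type bounds for the maximal function. -/

/-- The weak type `(1, 1)` inequality for the maximal function over cubes. -/
lemma volume_lt_cubeMaximal_le {n : ℕ} (hn : 1 ≤ n) (v : (Fin n → ℝ) → ℝ≥0∞) {y : ℝ≥0∞}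
    (hy : y ≠ 0) (hy' : y ≠ ∞) :
    volume {x | y < cubeMaximal v x} ≤ 5 ^ n * y⁻¹ * ∫⁻ x, v x := by
  by_cases hv : ∫⁻ x, v x = ∞
  · rw [hv, ENNReal.mul_top]
    · exact le_top
    · exact mul_ne_zero (by simp) (ENNReal.inv_ne_zero.2 hy')
  let t : Set ((Fin n → ℝ) × ℝ) :=
    {q | 0 < q.2 ∧ y * volume (cube q.1 q.2) < ∫⁻ z in cube q.1 q.2, v z}
  have hbound : ∀ q ∈ t, q.2 / 2 ≤ (max 1 ((∫⁻ x, v x) / y).toReal) / 2 := by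
    rintro ⟨a, h⟩ ⟨hh, hq⟩
    simp only at hh hq ⊢
    rcases le_total h 1 with h1 | h1
    · have := le_max_left 1 ((∫⁻ x, v x) / y).toReal
      linarith
    -- For h ≥ 1 and n ≥ 1, h ≤ h^n = |Q|, while y|Q| < ∫ v. This bounds the radii, as the Vitali
    -- covering lemma requires.
    have h2 : ENNReal.ofReal h ≤ (∫⁻ x, v x) / y := by
      rw [ENNReal.le_div_iff_mul_le (Or.inl hy) (Or.inl hy'), mul_comm]
      refine le_trans ?_ (hq.le.trans (setLIntegral_le_lintegral _ _))
      rw [volume_cube]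
      refine mul_le_mul_right (le_self_pow₀ ?_ (by omega)) _
      simpa using h1
    have h3 : h ≤ ((∫⁻ x, v x) / y).toReal :=
      (ENNReal.ofReal_le_iff_le_toReal (ENNReal.div_ne_top hv hy)).1 h2
    have := le_max_right 1 ((∫⁻ x, v x) / y).toReal
    linarith
  obtain ⟨u, hut, hdisj, hcov⟩ := Vitali.exists_disjoint_subfamily_covering_enlargement_closedBall
    t (fun q i => q.1 i + q.2 / 2) (fun q => q.2 / 2) _ hbound 5 (by norm_num)
  have hball : ∀ q ∈ t, Metric.closedBall (fun i => q.1 i + q.2 / 2) (q.2 / 2)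
      = cube q.1 q.2 := fun q hq => (cube_eq_closedBall q.1 hq.1.le).symm
  have hcount : u.Countable := by
    refine hdisj.countable_of_nonempty_interior fun q hq => ?_
    refine ⟨fun i => q.1 i + q.2 / 2, ?_⟩
    refine Metric.ball_subset_interior_closedBall (Metric.mem_ball_self ?_)
    exact half_pos (hut hq).1
  have hsub : {x | y < cubeMaximal v x} ⊆
      ⋃ q ∈ u, Metric.closedBall (fun i => q.1 i + q.2 / 2) (5 * (q.2 / 2)) := by
    intro x hx
    obtain ⟨a, h, hh, hxa, hlt⟩ := lt_cubeMaximal_iff.1 hx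
    have hat : ((a, h) : (Fin n → ℝ) × ℝ) ∈ t := by
      refine ⟨hh, ?_⟩
      rwa [← ENNReal.div_eq_inv_mul, ENNReal.lt_div_iff_mul_lt
        (Or.inl (volume_cube_ne_zero a hh)) (Or.inl (volume_cube_ne_top a h))] at hlt
    obtain ⟨b, hb, hsubb⟩ := hcov _ hat
    refine mem_biUnion hb (hsubb ?_)
    rw [hball _ hat]
    exact hxa
  have hvol : ∀ q ∈ u, volume (Metric.closedBall (fun i => q.1 i + q.2 / 2) (5 * (q.2 / 2)))
      ≤ 5 ^ n * y⁻¹ * ∫⁻ z in cube q.1 q.2, v z := by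
    intro q hq
    have hq0 := (hut hq).1
    rw [Real.volume_pi_closedBall _ (by positivity), Fintype.card_fin]
    have : 2 * (5 * (q.2 / 2)) = 5 * q.2 := by ring
    rw [this, mul_pow, ENNReal.ofReal_mul (by positivity), ENNReal.ofReal_pow (by norm_num),
      ENNReal.ofReal_pow hq0.le, mul_assoc]
    refine mul_le_mul' (le_of_eq (by norm_num)) ?_
    rw [← ENNReal.div_eq_inv_mul, ENNReal.le_div_iff_mul_le (Or.inl hy) (Or.inl hy'), mul_comm,
      ← volume_cube q.1]
    exact (hut hq).2.le
  have hdisj' : u.PairwiseDisjoint fun q => cube q.1 q.2 := by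
    intro p hp q hq hpq
    have := hdisj hp hq hpq
    simp only [Function.onFun] at this ⊢
    rwa [hball _ (hut hp), hball _ (hut hq)] at this
  calc volume {x | y < cubeMaximal v x}
      ≤ volume (⋃ q ∈ u, Metric.closedBall (fun i => q.1 i + q.2 / 2) (5 * (q.2 / 2))) :=
        measure_mono hsub
    _ ≤ ∑' q : u, volume (Metric.closedBall (fun i => q.1.1 i + q.1.2 / 2) (5 * (q.1.2 / 2))) :=
        measure_biUnion_le _ hcount _
    _ ≤ ∑' q : u, 5 ^ n * y⁻¹ * ∫⁻ z in cube q.1.1 q.1.2, v z :=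
        ENNReal.tsum_le_tsum fun q => hvol q.1 q.2
    _ = 5 ^ n * y⁻¹ * ∫⁻ z in ⋃ q ∈ u, cube q.1 q.2, v z := by
        rw [ENNReal.tsum_mul_left,
          lintegral_biUnion hcount (fun q _ => measurableSet_cube q.1 q.2) hdisj']
    _ ≤ 5 ^ n * y⁻¹ * ∫⁻ x, v x := mul_le_mul_right (setLIntegral_le_lintegral _ _) _

/-- The layer cake integral of y^{q-1} up to height a, with a = ∞ included because the maximal
function may be infinite. -/
lemma lintegral_Ioi_rpow_of_lt (a : ℝ≥0∞) {q : ℝ} (hq : 0 < q) :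
    ∫⁻ y in Ioi (0 : ℝ), {y : ℝ | ENNReal.ofReal y < a}.indicator
      (fun y => ENNReal.ofReal (y ^ (q - 1))) y = a ^ q / ENNReal.ofReal q := by
  have key : ∀ c : ℝ, 0 ≤ c → ∫⁻ y in Ioo 0 c, ENNReal.ofReal (y ^ (q - 1)) =
      ENNReal.ofReal c ^ q / ENNReal.ofReal q := by
    intro c hc
    have hint : IntervalIntegrable (fun y : ℝ => y ^ (q - 1)) volume 0 c :=
      intervalIntegral.intervalIntegrable_rpow' (by linarith)
    rw [intervalIntegrable_iff_integrableOn_Ioo_of_le hc] at hint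
    rw [← ofReal_integral_eq_lintegral_ofReal hint, ← integral_Ioc_eq_integral_Ioo,
      ← intervalIntegral.integral_of_le hc, integral_rpow (Or.inl (by linarith)),
      ENNReal.ofReal_rpow_of_nonneg hc hq.le, ← ENNReal.ofReal_div_of_pos hq]
    · simp [Real.zero_rpow hq.ne']
    · filter_upwards [ae_restrict_mem measurableSet_Ioo] with y hy
      exact Real.rpow_nonneg hy.1.le _
  have hmeas : MeasurableSet {y : ℝ | ENNReal.ofReal y < a} :=
    measurableSet_lt ENNReal.measurable_ofReal measurable_const
  rw [setLIntegral_indicator hmeas]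
  rcases eq_or_ne a ∞ with rfl | ha
  · rw [ENNReal.top_rpow_of_pos hq, ENNReal.top_div_of_ne_top ENNReal.ofReal_ne_top]
    refine ENNReal.eq_top_of_forall_nnreal_le fun r => ?_
    set c : ℝ := (r * q) ^ q⁻¹ with hc
    have hc0 : 0 ≤ c := by positivity
    have h1 : ENNReal.ofReal c ^ q / ENNReal.ofReal q = r := by
      rw [ENNReal.ofReal_rpow_of_nonneg hc0 hq.le, ← ENNReal.ofReal_div_of_pos hq, hc,
        Real.rpow_inv_rpow (by positivity) hq.ne', mul_div_cancel_right₀ _ hq.ne',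
        ENNReal.ofReal_coe_nnreal]
    rw [← h1, ← key c hc0]
    refine lintegral_mono_set fun y hy => ⟨?_, hy.1⟩
    simp
  · lift a to ℝ≥0 using ha
    have := key a a.2
    rw [ENNReal.ofReal_coe_nnreal] at this
    rw [← this]
    congr 2
    ext y
    simp only [mem_inter_iff, mem_ofPred_eq, mem_Ioi, mem_Ioo]
    rw [and_comm, and_congr_right_iff]
    intro hy
    rw [ENNReal.ofReal, ENNReal.coe_lt_coe, Real.toNNReal_lt_iff_lt_coe hy.le]

/-- The strong type `(1 + δ, 1 + δ)` inequality for the maximal function over cubes, with the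
sharp order `1 / δ` of the constant as `δ → 0`. -/
lemma lintegral_cubeMaximal_rpow_le {n : ℕ} (hn : 1 ≤ n) {v : (Fin n → ℝ) → ℝ≥0∞}
    (hv : Measurable v) {δ : ℝ} (hδ : 0 < δ) (hδ1 : δ ≤ 1) :
    ∫⁻ x, cubeMaximal v x ^ (1 + δ) ≤
      8 * 5 ^ n / ENNReal.ofReal δ * ∫⁻ x, v x ^ (1 + δ) := by
  have hp : (0 : ℝ) < 1 + δ := by linarith
  have hMmeas := measurable_cubeMaximal v
  -- The part of v of height at most y/2 has maximal function at most y/2, so only the part above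
  -- y/2 enters the weak type bound.
  have hlevel : ∀ y : ℝ, 0 < y → volume {x | ENNReal.ofReal y < cubeMaximal v x} ≤
      5 ^ n * 2 * (ENNReal.ofReal y)⁻¹ * ∫⁻ x, {x | ENNReal.ofReal y < 2 * v x}.indicator v x := by
    intro y hy
    have hy0 : ENNReal.ofReal y ≠ 0 := by simpa using hy
    have hy2 : (ENNReal.ofReal y / 2)⁻¹ = 2 * (ENNReal.ofReal y)⁻¹ := by
      rw [ENNReal.inv_div (by simp) (by simp), div_eq_mul_inv]
    rw [mul_assoc (5 ^ n : ℝ≥0∞), ← hy2]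
    refine le_trans (measure_mono fun x hx => ?_) (volume_lt_cubeMaximal_le hn _ ?_ ?_)
    · have h1 : cubeMaximal v x ≤
          cubeMaximal ({x | ENNReal.ofReal y < 2 * v x}.indicator v) x + ENNReal.ofReal y / 2 := by
        refine le_trans (cubeMaximal_mono (fun z => ?_) x) (cubeMaximal_add_const_le _ _ x)
        by_cases hz : ENNReal.ofReal y < 2 * v z
        · rw [indicator_of_mem (by exact hz)]
          exact le_self_add
        · rw [indicator_of_notMem (by exact hz), zero_add,
            ENNReal.le_div_iff_mul_le (by simp) (by simp), mul_comm]
          exact not_lt.1 hz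
      have h2 : ENNReal.ofReal y / 2 + ENNReal.ofReal y / 2 <
          cubeMaximal ({x | ENNReal.ofReal y < 2 * v x}.indicator v) x + ENNReal.ofReal y / 2 := by
        rw [ENNReal.add_halves]
        exact lt_of_lt_of_le hx h1
      exact lt_of_add_lt_add_right h2
    · exact (ENNReal.half_pos hy0).ne'
    · exact ENNReal.div_ne_top ENNReal.ofReal_ne_top (by simp)
  have hcake : ∀ x, cubeMaximal v x ^ (1 + δ) = ENNReal.ofReal (1 + δ) *
      ∫⁻ y in Ioi (0 : ℝ), {y : ℝ | ENNReal.ofReal y < cubeMaximal v x}.indicator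
        (fun y => ENNReal.ofReal (y ^ (1 + δ - 1))) y := by
    intro x
    rw [lintegral_Ioi_rpow_of_lt _ hp, ENNReal.mul_div_cancel]
    · simpa using hp
    · simp
  -- After interchanging the integrals, this one produces the factor 1/δ.
  have hcake2 : ∀ x, ∫⁻ y in Ioi (0 : ℝ), {y : ℝ | ENNReal.ofReal y < 2 * v x}.indicator
        (fun y => ENNReal.ofReal (y ^ (δ - 1))) y = (2 * v x) ^ δ / ENNReal.ofReal δ := fun x =>
    lintegral_Ioi_rpow_of_lt _ hδ
  have hjoint1 : Measurable fun q : (Fin n → ℝ) × ℝ =>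
      {y : ℝ | ENNReal.ofReal y < cubeMaximal v q.1}.indicator
        (fun y => ENNReal.ofReal (y ^ (1 + δ - 1))) q.2 := by
    have : (fun q : (Fin n → ℝ) × ℝ =>
      {y : ℝ | ENNReal.ofReal y < cubeMaximal v q.1}.indicator
        (fun y => ENNReal.ofReal (y ^ (1 + δ - 1))) q.2) =
      {q : (Fin n → ℝ) × ℝ | ENNReal.ofReal q.2 < cubeMaximal v q.1}.indicator
        (fun q => ENNReal.ofReal (q.2 ^ (1 + δ - 1))) := by
      ext q
      simp [indicator]
    rw [this]
    refine Measurable.indicator (by fun_prop) (measurableSet_lt (by fun_prop) ?_)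
    exact hMmeas.comp measurable_fst
  have hjoint2 : Measurable fun q : (Fin n → ℝ) × ℝ =>
      v q.1 * {y : ℝ | ENNReal.ofReal y < 2 * v q.1}.indicator
        (fun y => ENNReal.ofReal (y ^ (δ - 1))) q.2 := by
    have : (fun q : (Fin n → ℝ) × ℝ =>
      v q.1 * {y : ℝ | ENNReal.ofReal y < 2 * v q.1}.indicator
        (fun y => ENNReal.ofReal (y ^ (δ - 1))) q.2) = fun q => v q.1 *
      {q : (Fin n → ℝ) × ℝ | ENNReal.ofReal q.2 < 2 * v q.1}.indicator
        (fun q => ENNReal.ofReal (q.2 ^ (δ - 1))) q := by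
      ext q
      simp [indicator]
    rw [this]
    have hv1 : Measurable fun q : (Fin n → ℝ) × ℝ => v q.1 := hv.comp measurable_fst
    refine hv1.mul (Measurable.indicator (by fun_prop) (measurableSet_lt (by fun_prop) ?_))
    exact hv1.const_mul 2
  have hinner : ∀ y ∈ Ioi (0 : ℝ), ∫⁻ x, {y : ℝ | ENNReal.ofReal y < cubeMaximal v x}.indicator
        (fun y => ENNReal.ofReal (y ^ (1 + δ - 1))) y ≤
      5 ^ n * 2 * ∫⁻ x, v x * {y : ℝ | ENNReal.ofReal y < 2 * v x}.indicator
        (fun y => ENNReal.ofReal (y ^ (δ - 1))) y := by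
    intro y hy
    have hy : 0 < y := hy
    have e1 : ∀ x, {y : ℝ | ENNReal.ofReal y < cubeMaximal v x}.indicator
        (fun y => ENNReal.ofReal (y ^ (1 + δ - 1))) y =
        {x | ENNReal.ofReal y < cubeMaximal v x}.indicator
          (fun _ => ENNReal.ofReal (y ^ (1 + δ - 1))) x := fun x => by simp [indicator]
    have e2 : ∀ x, v x * {y : ℝ | ENNReal.ofReal y < 2 * v x}.indicator
        (fun y => ENNReal.ofReal (y ^ (δ - 1))) y =
        ENNReal.ofReal (y ^ (δ - 1)) * {x | ENNReal.ofReal y < 2 * v x}.indicator v x :=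
      fun x => by simp [indicator, mul_comm]
    simp_rw [e1, e2]
    rw [lintegral_indicator_const (measurableSet_lt measurable_const hMmeas),
      lintegral_const_mul _ (hv.indicator (measurableSet_lt measurable_const (hv.const_mul 2)))]
    refine (mul_le_mul_right (hlevel y hy) _).trans (le_of_eq ?_)
    have e3 : ENNReal.ofReal (y ^ (1 + δ - 1)) * (ENNReal.ofReal y)⁻¹ =
        ENNReal.ofReal (y ^ (δ - 1)) := by
      rw [← ENNReal.ofReal_inv_of_pos hy, ← ENNReal.ofReal_mul (by positivity)]
      congr 1
      rw [show 1 + δ - 1 = (δ - 1) + 1 by ring, Real.rpow_add hy, Real.rpow_one,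
        mul_inv_cancel_right₀ hy.ne']
    rw [← e3]
    ring
  calc ∫⁻ x, cubeMaximal v x ^ (1 + δ)
      = ENNReal.ofReal (1 + δ) * ∫⁻ x, ∫⁻ y in Ioi (0 : ℝ),
        {y : ℝ | ENNReal.ofReal y < cubeMaximal v x}.indicator
        (fun y => ENNReal.ofReal (y ^ (1 + δ - 1))) y := by
        simp_rw [hcake]
        rw [lintegral_const_mul _ hjoint1.lintegral_prod_right']
    _ = ENNReal.ofReal (1 + δ) * ∫⁻ y in Ioi (0 : ℝ), ∫⁻ x,
        {y : ℝ | ENNReal.ofReal y < cubeMaximal v x}.indicator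
        (fun y => ENNReal.ofReal (y ^ (1 + δ - 1))) y := by
        rw [lintegral_lintegral_swap hjoint1.aemeasurable]
    _ ≤ 2 * ∫⁻ y in Ioi (0 : ℝ), 5 ^ n * 2 * ∫⁻ x,
        v x * {y : ℝ | ENNReal.ofReal y < 2 * v x}.indicator
        (fun y => ENNReal.ofReal (y ^ (δ - 1))) y := by
        refine mul_le_mul' ?_ (setLIntegral_mono' measurableSet_Ioi hinner)
        refine ENNReal.ofReal_le_of_le_toReal ?_
        simp only [ENNReal.toReal_ofNat]
        linarith
    _ = 2 * (5 ^ n * 2 * ∫⁻ x, ∫⁻ y in Ioi (0 : ℝ),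
        v x * {y : ℝ | ENNReal.ofReal y < 2 * v x}.indicator
        (fun y => ENNReal.ofReal (y ^ (δ - 1))) y) := by
        rw [lintegral_const_mul _ hjoint2.lintegral_prod_left',
          lintegral_lintegral_swap (f := fun x y =>
            v x * {y : ℝ | ENNReal.ofReal y < 2 * v x}.indicator
              (fun y => ENNReal.ofReal (y ^ (δ - 1))) y) hjoint2.aemeasurable]
    _ = 2 * (5 ^ n * 2 * ∫⁻ x, v x * ((2 * v x) ^ δ / ENNReal.ofReal δ)) := by
        congr 3
        ext x
        rw [lintegral_const_mul, hcake2]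
        exact Measurable.indicator (by fun_prop) (measurableSet_lt (by fun_prop) measurable_const)
    _ ≤ 2 * (5 ^ n * 2 * ∫⁻ x, 2 / ENNReal.ofReal δ * v x ^ (1 + δ)) := by
        refine mul_le_mul_right (mul_le_mul_right (lintegral_mono fun x => ?_) _) _
        rw [ENNReal.mul_rpow_of_nonneg _ _ hδ.le, ENNReal.rpow_add_of_nonneg _ _ (by norm_num) hδ.le,
          ENNReal.rpow_one, div_eq_mul_inv, div_eq_mul_inv]
        have h2 : (2 : ℝ≥0∞) ^ δ ≤ 2 := by
          simpa using ENNReal.rpow_le_rpow_of_exponent_le (x := 2) (by norm_num) hδ1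
        calc v x * (2 ^ δ * v x ^ δ * (ENNReal.ofReal δ)⁻¹)
            ≤ v x * (2 * v x ^ δ * (ENNReal.ofReal δ)⁻¹) := by gcongr
          _ = _ := by ring
    _ = 8 * 5 ^ n / ENNReal.ofReal δ * ∫⁻ x, v x ^ (1 + δ) := by
        rw [lintegral_const_mul _ (by fun_prop), div_eq_mul_inv, div_eq_mul_inv]
        ring

/-! ### A₁ weights adapted to a set. -/

lemma lintegral_iterate_cubeMaximal_rpow_le {n : ℕ} (hn : 1 ≤ n) {v : (Fin n → ℝ) → ℝ≥0∞}
    (hv : Measurable v) {δ : ℝ} (hδ : 0 < δ) (hδ1 : δ ≤ 1) (j : ℕ) :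
    Measurable (cubeMaximal^[j] v) ∧ ∫⁻ x, (cubeMaximal^[j] v) x ^ (1 + δ) ≤
      (8 * 5 ^ n / ENNReal.ofReal δ) ^ j * ∫⁻ x, v x ^ (1 + δ) := by
  induction j with
  | zero => simpa using hv
  | succ j ih =>
    rw [Function.iterate_succ_apply']
    refine ⟨measurable_cubeMaximal _, (lintegral_cubeMaximal_rpow_le hn ih.1 hδ hδ1).trans ?_⟩
    rw [pow_succ', mul_assoc]
    exact mul_le_mul_right ih.2 _

/-- Hölder's inequality with exponents 1 + δ and (1 + δ)/δ against the constant 1 on S. -/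
lemma setLIntegral_le_rpow_mul_measure {α : Type*} [MeasurableSpace α] (μ : Measure α)
    {v : α → ℝ≥0∞} (hv : Measurable v) {δ : ℝ} (hδ : 0 < δ) (S : Set α) :
    ∫⁻ x in S, v x ∂μ ≤ (∫⁻ x, v x ^ (1 + δ) ∂μ) ^ (1 / (1 + δ)) * μ S ^ (δ / (1 + δ)) := by
  have hconj : (1 + δ).HolderConjugate ((1 + δ) / δ) := by
    rw [Real.holderConjugate_iff]
    refine ⟨by linarith, ?_⟩
    field_simp
  have h := ENNReal.lintegral_mul_le_Lp_mul_Lq (μ.restrict S) hconj (f := v) (g := fun _ => 1)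
    hv.aemeasurable aemeasurable_const
  simp only [Pi.mul_apply, mul_one, ENNReal.one_rpow, lintegral_one, Measure.restrict_apply_univ,
    one_div_div] at h
  refine h.trans (mul_le_mul_left (ENNReal.rpow_le_rpow (setLIntegral_le_lintegral _ _) ?_) _)
  positivity

/-- The cubes centred at x exhaust the space; if the maximal function vanished at x, each of them
would meet F in a null set. This makes the weight positive off F as well. -/
lemma cubeMaximal_indicator_pos {n : ℕ} {F : Set (Fin n → ℝ)} (hF : MeasurableSet F)
    (hF0 : volume F ≠ 0) (x : Fin n → ℝ) : 0 < cubeMaximal (F.indicator 1) x := by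
  rw [pos_iff_ne_zero]
  intro h0
  refine hF0 (measure_mono_null (t := ⋃ m : ℕ, F ∩ cube (fun i => x i - m) (2 * m)) ?_ ?_)
  · intro z hz
    obtain ⟨m, hm⟩ := exists_nat_ge (dist z x)
    refine mem_iUnion.2 ⟨m, hz, ?_, ?_⟩
    · intro i
      have := abs_le.1 ((Real.dist_eq _ _).symm.le.trans ((dist_le_pi_dist z x i).trans hm))
      simp only
      linarith
    · intro i
      have := abs_le.1 ((Real.dist_eq _ _).symm.le.trans ((dist_le_pi_dist z x i).trans hm))
      simp only
      linarith
  · refine measure_iUnion_null fun m => ?_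
    rcases Nat.eq_zero_or_pos m with rfl | hm
    · by_contra hne
      have h1 := average_le_cubeMaximal (F.indicator 1) (x := x) (a := x) (h := 1) one_pos
        ⟨le_rfl, fun i => by simp⟩
      rw [h0, nonpos_iff_eq_zero, mul_eq_zero, lintegral_indicator_one hF,
        Measure.restrict_apply hF] at h1
      rcases h1 with h1 | h1
      · exact volume_cube_ne_top _ _ (ENNReal.inv_eq_zero.1 h1)
      · refine hne (measure_mono_null (inter_subset_inter_right F ?_) h1)
        exact Icc_subset_Icc (fun i => by simp) (fun i => by simp)
    · have hm' : (0 : ℝ) < m := by exact_mod_cast hm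
      have h1 := average_le_cubeMaximal (F.indicator 1) (x := x) (a := fun i => x i - m)
        (h := 2 * m) (by positivity)
        ⟨fun i => by simp, fun i => by simp only; linarith⟩
      rw [h0, nonpos_iff_eq_zero, mul_eq_zero, lintegral_indicator_one hF,
        Measure.restrict_apply hF] at h1
      rcases h1 with h1 | h1
      · exact absurd (ENNReal.inv_eq_zero.1 h1) (volume_cube_ne_top _ _)
      · exact h1

/-- The Rubio de Francia algorithm, applied to the indicator function of a set. -/
lemma exists_majorant_of_indicator {n : ℕ} (hn : 1 ≤ n) {F : Set (Fin n → ℝ)}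
    (hF : MeasurableSet F) (hF0 : volume F ≠ 0) {δ : ℝ} (hδ : 0 < δ) (hδ1 : δ ≤ 1) :
    ∃ U : (Fin n → ℝ) → ℝ≥0∞, Measurable U ∧ (∀ x ∈ F, 1 ≤ U x) ∧ (∀ x, 0 < U x) ∧
      (∀ S : Set (Fin n → ℝ), ∫⁻ x in S, U x ≤
        2 * (volume F ^ (1 / (1 + δ)) * volume S ^ (δ / (1 + δ)))) ∧
      ∀ x, cubeMaximal U x ≤ 2 * (8 * 5 ^ n / ENNReal.ofReal δ) * U x := by
  set B : ℝ≥0∞ := 8 * 5 ^ n / ENNReal.ofReal δ with hB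
  have hB1 : 1 ≤ B := by
    rw [hB, ENNReal.le_div_iff_mul_le (Or.inr (by simp)) (Or.inl (by simp)), one_mul]
    calc ENNReal.ofReal δ ≤ 1 := by simpa using hδ1
      _ ≤ 8 * 5 ^ n := by
        exact_mod_cast Nat.one_le_iff_ne_zero.2 (by positivity : 8 * 5 ^ n ≠ 0)
  have hBtop : B ≠ ∞ :=
    ENNReal.div_ne_top (ENNReal.mul_ne_top (by simp) (by simp)) (by simpa using hδ)
  have h2B0 : 2 * B ≠ 0 := mul_ne_zero (by simp) (zero_lt_one.trans_le hB1).ne'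
  have h2Btop : 2 * B ≠ ∞ := ENNReal.mul_ne_top (by simp) hBtop
  set v : (Fin n → ℝ) → ℝ≥0∞ := F.indicator 1 with hvdef
  have hv : Measurable v := measurable_one.indicator hF
  have hvp : ∫⁻ x, v x ^ (1 + δ) = volume F := by
    rw [← lintegral_indicator_one hF]
    refine lintegral_congr fun x => ?_
    by_cases hx : x ∈ F
    · simp [hvdef, hx]
    · simp [hvdef, hx, show (0 : ℝ) < 1 + δ by linarith]
  have hiter := lintegral_iterate_cubeMaximal_rpow_le hn hv hδ hδ1
  refine ⟨fun x => ∑' j, ((2 * B)⁻¹) ^ j * (cubeMaximal^[j] v) x, ?_, ?_, ?_, ?_, ?_⟩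
  · exact Measurable.tsum fun j => (hiter j).1.const_mul _
  · intro x hx
    refine le_trans (le_of_eq ?_) (ENNReal.le_tsum 0)
    simp [hvdef, hx]
  · intro x
    -- The term j = 0 vanishes off F, so positivity is read off the term j = 1.
    refine lt_of_lt_of_le ?_ (ENNReal.le_tsum 1)
    rw [pow_one, Function.iterate_one]
    exact ENNReal.mul_pos (ENNReal.inv_ne_zero.2 h2Btop) (cubeMaximal_indicator_pos hF hF0 x).ne'
  · intro S
    rw [lintegral_tsum fun j => ((hiter j).1.const_mul _).aemeasurable]
    calc ∑' j, ∫⁻ x in S, ((2 * B)⁻¹) ^ j * (cubeMaximal^[j] v) x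
        ≤ ∑' j : ℕ, (2⁻¹ : ℝ≥0∞) ^ j *
            (volume F ^ (1 / (1 + δ)) * volume S ^ (δ / (1 + δ))) := by
          refine ENNReal.tsum_le_tsum fun j => ?_
          rw [lintegral_const_mul _ (hiter j).1]
          have h1 : ∫⁻ x in S, (cubeMaximal^[j] v) x ≤
              B ^ j * (volume F ^ (1 / (1 + δ)) * volume S ^ (δ / (1 + δ))) := by
            refine (setLIntegral_le_rpow_mul_measure _ (hiter j).1 hδ S).trans ?_
            rw [← mul_assoc]
            refine mul_le_mul_left ?_ _
            refine (ENNReal.rpow_le_rpow ((hiter j).2.trans_eq (by rw [hvp]))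
              (by positivity)).trans ?_
            rw [ENNReal.mul_rpow_of_nonneg _ _ (by positivity)]
            refine mul_le_mul_left ?_ _
            refine (ENNReal.rpow_le_rpow_of_exponent_le (one_le_pow₀ hB1)
              (z := 1) ?_).trans_eq (ENNReal.rpow_one _)
            rw [div_le_one (by linarith)]
            linarith
          refine (mul_le_mul_right h1 _).trans_eq ?_
          rw [← mul_assoc, ← mul_pow, ENNReal.mul_inv (by simp) (by simp), mul_assoc,
            ENNReal.inv_mul_cancel (zero_lt_one.trans_le hB1).ne' hBtop, mul_one]
      _ = 2 * (volume F ^ (1 / (1 + δ)) * volume S ^ (δ / (1 + δ))) := by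
          rw [ENNReal.tsum_mul_right, ENNReal.tsum_geometric, ENNReal.one_sub_inv_two, inv_inv]
  · intro x
    refine (cubeMaximal_tsum_le (fun j => (hiter j).1) _ x).trans ?_
    rw [← ENNReal.tsum_mul_left]
    -- Applying the maximal operator shifts the series by one index at the price of the factor 2B;
    -- the shifted series is a subseries of the original.
    calc ∑' j, ((2 * B)⁻¹) ^ j * cubeMaximal (cubeMaximal^[j] v) x
        = ∑' j, 2 * B * (((2 * B)⁻¹) ^ (j + 1) * (cubeMaximal^[j + 1] v) x) := by
          refine tsum_congr fun j => ?_
          rw [Function.iterate_succ_apply', pow_succ', ← mul_assoc, ← mul_assoc,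
            ENNReal.mul_inv_cancel h2B0 h2Btop, one_mul]
      _ ≤ ∑' j, 2 * B * (((2 * B)⁻¹) ^ j * (cubeMaximal^[j] v) x) :=
          ENNReal.tsum_comp_le_tsum_of_injective (add_left_injective 1)
            (fun j => 2 * B * (((2 * B)⁻¹) ^ j * (cubeMaximal^[j] v) x))

lemma a1Norm_le {n : ℕ} {u : (Fin n → ℝ) → ℝ} {c : ℝ≥0∞} (h : A1Bound u c) : a1Norm u ≤ c :=
  sInf_le h

/-- For a set `F` of finite positive measure there is an `A₁` weight that is at least `1` on `F`,
has `A₁` norm `O(1 / δ)`, and is controlled in `L^{1 + δ}` by the indicator of `F`. -/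
lemma exists_isA1_ge_one_on {n : ℕ} (hn : 1 ≤ n) {F : Set (Fin n → ℝ)}
    (hF : MeasurableSet F) (hF0 : volume F ≠ 0) (hFtop : volume F ≠ ∞) {δ : ℝ} (hδ : 0 < δ)
    (hδ1 : δ ≤ 1) :
    ∃ u : (Fin n → ℝ) → ℝ, IsA1 u ∧ volume F ≤ weightMeasure u F ∧
      (∀ S : Set (Fin n → ℝ), ∫⁻ x in S, ENNReal.ofReal (u x) ≤
        2 * (volume F ^ (1 / (1 + δ)) * volume S ^ (δ / (1 + δ)))) ∧
      a1Norm u ≤ 2 * (8 * 5 ^ n / ENNReal.ofReal δ) := by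
  obtain ⟨U, hU, hUF, hUpos, hUS, hUM⟩ := exists_majorant_of_indicator hn hF hF0 hδ hδ1
  have hfin : ∀ S : Set (Fin n → ℝ), volume S < ∞ → ∫⁻ x in S, U x < ∞ := fun S hS => by
    refine (hUS S).trans_lt (ENNReal.mul_lt_top (by simp) (ENNReal.mul_lt_top ?_ ?_))
    · exact ENNReal.rpow_lt_top_of_nonneg (by positivity) hFtop
    · exact ENNReal.rpow_lt_top_of_nonneg (by positivity) hS.ne
  have hae : ∀ᵐ x, U x < ∞ := ae_of_forall_measure_lt_top_ae_restrict _ fun S _ hS =>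
    ae_lt_top hU (hfin S hS).ne
  have hle : ∀ x, ENNReal.ofReal (U x).toReal ≤ U x := fun x => ENNReal.ofReal_toReal_le
  have hmeas : Measurable fun x => (U x).toReal := hU.ennreal_toReal
  have hbound : A1Bound (fun x => (U x).toReal) (2 * (8 * 5 ^ n / ENNReal.ofReal δ)) := by
    filter_upwards [hae] with x hx
    rw [ENNReal.ofReal_toReal hx.ne]
    refine le_trans ?_ (hUM x)
    refine cubeMaximal_mono (v := fun y => ‖(U y).toReal‖ₑ) (fun y => ?_) x
    change ‖(U y).toReal‖ₑ ≤ U y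
    rw [Real.enorm_of_nonneg ENNReal.toReal_nonneg]
    exact hle y
  have hC : 2 * (8 * 5 ^ n / ENNReal.ofReal δ) ≠ ∞ :=
    ENNReal.mul_ne_top (by simp)
      (ENNReal.div_ne_top (ENNReal.mul_ne_top (by simp) (by simp)) (by simpa using hδ))
  refine ⟨fun x => (U x).toReal, ⟨?_, ?_, ?_⟩, ?_, ?_, a1Norm_le hbound⟩
  · filter_upwards [hae] with x hx
    exact ENNReal.toReal_pos (hUpos x).ne' hx.ne
  · rw [locallyIntegrable_iff]
    intro S hS
    refine ⟨hmeas.aestronglyMeasurable, ?_⟩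
    refine lt_of_le_of_lt (lintegral_mono fun x => ?_) (hfin S hS.measure_lt_top)
    rw [Real.enorm_of_nonneg ENNReal.toReal_nonneg]
    exact hle x
  · lift 2 * (8 * 5 ^ n / ENNReal.ofReal δ) to ℝ≥0 using hC with c
    exact ⟨c, hbound⟩
  · rw [weightMeasure, withDensity_apply _ hF, ← setLIntegral_one]
    refine setLIntegral_mono_ae' hF ?_
    filter_upwards [hae] with x hx hxF
    rw [ENNReal.ofReal_toReal hx.ne]
    exact hUF x hxF
  · exact fun S => (lintegral_mono fun x => hle x).trans (hUS S)

/-! ### The estimate for bounded functions supported on sets of finite measure. -/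

lemma hlMaximal_one_le {n : ℕ} (x : Fin n → ℝ) : hlMaximal (fun _ => 1) x ≤ 1 := by
  refine iSup₂_le fun a h => iSup₂_le fun hh _ => ?_
  simp only [enorm_one, setLIntegral_const, one_mul]
  exact (ENNReal.inv_mul_cancel (volume_cube_ne_zero a hh) (volume_cube_ne_top a h)).le

lemma a1Bound_one {n : ℕ} : A1Bound (n := n) (fun _ => 1) 1 :=
  Filter.Eventually.of_forall fun x => by simpa using hlMaximal_one_le x

lemma isA1_one {n : ℕ} : IsA1 (n := n) (fun _ => 1) :=
  ⟨by simp, locallyIntegrable_const _, 1, by simpa using a1Bound_one⟩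

lemma weightMeasure_one {n : ℕ} : weightMeasure (n := n) (fun _ => 1) = volume := by
  simp [weightMeasure]

lemma ofReal_mul_measure_le_weakL1Norm {α 𝕜 : Type*} [MeasurableSpace α] [RCLike 𝕜] (g : α → 𝕜)
    (μ : Measure α) {y : ℝ} (hy : 0 < y) :
    ENNReal.ofReal y * μ {x | y < ‖g x‖} ≤ weakL1Norm g μ :=
  le_iSup₂_of_le y hy le_rfl

/-- The distribution function is right continuous: the superlevel set at y is the increasing union
of those at y + 1/(j + 1). -/
lemma measure_lt_norm_le_of_forall_gt {α 𝕜 : Type*} [MeasurableSpace α] [RCLike 𝕜] {g : α → 𝕜}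
    {μ : Measure α} {y : ℝ} {m : ℝ≥0∞} (h : ∀ y' > y, μ {x | y' < ‖g x‖} ≤ m) :
    μ {x | y < ‖g x‖} ≤ m := by
  have hU : {x | y < ‖g x‖} = ⋃ j : ℕ, {x | y + 1 / ((j : ℝ) + 1) < ‖g x‖} := by
    ext x
    simp only [mem_ofPred_eq, mem_iUnion]
    constructor
    · intro hx
      obtain ⟨j, hj⟩ := exists_nat_one_div_lt (sub_pos.2 hx)
      exact ⟨j, by linarith⟩
    · rintro ⟨j, hj⟩
      have : 0 < 1 / ((j : ℝ) + 1) := by positivity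
      linarith
  have hmono : Monotone fun j : ℕ => {x | y + 1 / ((j : ℝ) + 1) < ‖g x‖} := by
    intro i j hij x hx
    have : 1 / ((j : ℝ) + 1) ≤ 1 / ((i : ℝ) + 1) := one_div_le_one_div_of_le (by positivity)
      (by exact_mod_cast Nat.succ_le_succ hij)
    simp only [mem_ofPred_eq] at hx ⊢
    linarith
  rw [hU, hmono.measure_iUnion]
  exact iSup_le fun j => h _ (by have : 0 < 1 / ((j : ℝ) + 1) := by positivity
                                 linarith)

lemma lintegral_enorm_le_of_bounded {α 𝕜 : Type*} [MeasurableSpace α] [RCLike 𝕜] (μ : Measure α)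
    {h : α → 𝕜} {l : ℝ} (hl : ∀ x, ‖h x‖ ≤ l) :
    ∫⁻ x, ‖h x‖ₑ ∂μ ≤ ENNReal.ofReal l * μ (Function.support h) := by
  refine le_trans (lintegral_mono fun x => ?_) (lintegral_indicator_const_le _ _)
  by_cases hx : h x = 0
  · simp [hx]
  · rw [indicator_of_mem (Function.mem_support.2 hx), ← ofReal_norm]
    exact ENNReal.ofReal_le_ofReal (hl x)

/-- Since σ ≤ (s/τ) t, the product is at most (s/τ)^{δ/(1+δ)} t, and δ log(s/τ) ≤ 1 keeps that power
at most e < 3. -/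
lemma rpow_mul_rpow_le {t σ : ℝ≥0∞} {s τ : ℝ} (hτ : 0 < τ) (hs : τ ≤ s) (ht0 : t ≠ 0)
    (htop : t ≠ ∞) (hτt : ENNReal.ofReal τ ≤ t) (hσ : σ ≤ ENNReal.ofReal s) {δ : ℝ} (hδ : 0 < δ)
    (hδ1 : δ * Real.log (s / τ) ≤ 1) :
    t ^ (1 / (1 + δ)) * σ ^ (δ / (1 + δ)) ≤ 3 * t := by
  have hr : 1 ≤ s / τ := (one_le_div hτ).2 hs
  have hb : 0 ≤ δ / (1 + δ) := by positivity
  have hσ' : σ ≤ ENNReal.ofReal (s / τ) * t := by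
    refine hσ.trans (le_trans (le_of_eq ?_) (mul_le_mul_right hτt _))
    rw [← ENNReal.ofReal_mul (by positivity), div_mul_cancel₀ _ hτ.ne']
  have h3 : ENNReal.ofReal (s / τ) ^ (δ / (1 + δ)) ≤ 3 := by
    rw [ENNReal.ofReal_rpow_of_pos (by positivity)]
    refine ENNReal.ofReal_le_of_le_toReal ?_
    rw [ENNReal.toReal_ofNat, Real.rpow_def_of_pos (by positivity)]
    refine (Real.exp_le_exp.2 ?_).trans (Real.exp_one_lt_d9.le.trans (by norm_num))
    refine le_trans ?_ hδ1
    rw [mul_comm]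
    refine mul_le_mul_of_nonneg_right ?_ (Real.log_nonneg hr)
    exact div_le_self hδ.le (by linarith)
  calc t ^ (1 / (1 + δ)) * σ ^ (δ / (1 + δ))
      ≤ t ^ (1 / (1 + δ)) * (ENNReal.ofReal (s / τ) * t) ^ (δ / (1 + δ)) := by gcongr
    _ = ENNReal.ofReal (s / τ) ^ (δ / (1 + δ)) * (t ^ (1 / (1 + δ)) * t ^ (δ / (1 + δ))) := by
        rw [ENNReal.mul_rpow_of_nonneg _ _ hb]
        ring
    _ = ENNReal.ofReal (s / τ) ^ (δ / (1 + δ)) * t := by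
        rw [← ENNReal.rpow_add _ _ ht0 htop, ← add_div, div_self (by positivity), ENNReal.rpow_one]
    _ ≤ 3 * t := by gcongr

lemma aestronglyMeasurable_weightMeasure {n : ℕ} {𝕜 : Type*} [RCLike 𝕜] {h : (Fin n → ℝ) → 𝕜}
    (hh : AEStronglyMeasurable h volume) (u : (Fin n → ℝ) → ℝ) :
    AEStronglyMeasurable h (weightMeasure u) :=
  hh.mono_ac (withDensity_absolutelyContinuous _ _)

/-- The bound for bounded functions with support of finite measure. -/
lemma volume_lt_norm_apply_le {n : ℕ} (hn : 1 ≤ n) {𝕜 : Type*} [RCLike 𝕜] {k : ℕ} {C : ℝ≥0}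
    {T : ((Fin n → ℝ) → 𝕜) → ((Fin n → ℝ) → 𝕜)}
    (hT : ∀ u : (Fin n → ℝ) → ℝ, IsA1 u →
      BoundedL1WeakL1 T (weightMeasure u) ((C : ℝ≥0∞) * a1Norm u ^ k))
    {h : (Fin n → ℝ) → 𝕜} (hh : AEStronglyMeasurable h volume) {l : ℝ} (hl0 : 0 ≤ l)
    (hl : ∀ x, ‖h x‖ ≤ l) {s τ : ℝ} (hτ : 0 < τ) (hs : τ ≤ s)
    (hsupp : volume (Function.support h) ≤ ENNReal.ofReal s) :
    volume {x | 6 * C * (32 * 5 ^ n) ^ k * (1 + Real.log (s / τ)) ^ k * l < ‖T h x‖} ≤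
      ENNReal.ofReal τ := by
  set L : ℝ := 1 + Real.log (s / τ) with hL
  have hlog : 0 ≤ Real.log (s / τ) := Real.log_nonneg ((one_le_div hτ).2 hs)
  have hL1 : 1 ≤ L := by linarith
  refine measure_lt_norm_le_of_forall_gt fun y hy => ?_
  have hy0 : 0 < y := lt_of_le_of_lt (by positivity) hy
  by_contra! hlt
  have hmemLp : ∀ u : (Fin n → ℝ) → ℝ, weightMeasure u (Function.support h) < ∞ →
      MemLp h 1 (weightMeasure u) := fun u hu => by
    refine ⟨aestronglyMeasurable_weightMeasure hh u, ?_⟩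
    rw [eLpNorm_one_eq_lintegral_enorm]
    exact (lintegral_enorm_le_of_bounded _ hl).trans_lt (ENNReal.mul_lt_top (by simp) hu)
  have hTmeas : AEStronglyMeasurable (T h) volume := by
    have := (hT _ isA1_one h (hmemLp _ ?_)).1
    · rwa [weightMeasure_one] at this
    · rw [weightMeasure_one]
      exact hsupp.trans_lt (by simp)
  have hnull : NullMeasurableSet {x | y < ‖T h x‖} volume :=
    nullMeasurableSet_lt aemeasurable_const hTmeas.norm.aemeasurable
  obtain ⟨G, hGsub, hG, hGae⟩ := hnull.exists_measurable_subset_ae_eq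
  rw [← measure_congr hGae] at hlt
  -- The level set may have infinite measure, whereas the weight needs a set of finite measure; a
  -- subset of measure still larger than τ suffices.
  obtain ⟨F, hF, hFG, hτF, hFtop⟩ := Measure.exists_subset_measure_lt_top hG hlt
  have hF0 : volume F ≠ 0 := (bot_le.trans_lt hτF).ne'
  -- The choice δ = 1/L makes the support of h have weight at most 6|F| and the A₁ norm at most
  -- 16·5^n·L. The factor |F| then cancels from the weak type inequality.
  have hδ : 0 < 1 / L := by positivity
  have hδ1 : 1 / L ≤ 1 := (div_le_one (by positivity)).2 hL1
  obtain ⟨u, hu, huF, huS, huA⟩ := exists_isA1_ge_one_on hn hF hF0 hFtop.ne hδ hδ1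
  have hwS : weightMeasure u (Function.support h) ≤ 2 * (3 * volume F) := by
    rw [weightMeasure, withDensity_apply']
    refine (huS _).trans (mul_le_mul_right ?_ _)
    refine rpow_mul_rpow_le hτ hs hF0 hFtop.ne hτF.le hsupp hδ ?_
    rw [one_div, inv_mul_le_one₀ (by positivity)]
    linarith
  have hA : a1Norm u ≤ ENNReal.ofReal (32 * 5 ^ n * L) := by
    refine huA.trans ?_
    have e : (8 * 5 ^ n : ℝ≥0∞) = ENNReal.ofReal (8 * 5 ^ n) := by
      rw [ENNReal.ofReal_mul (by norm_num), ENNReal.ofReal_pow (by norm_num)]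
      norm_num
    rw [e, ← ENNReal.ofReal_div_of_pos hδ, show (2 : ℝ≥0∞) = ENNReal.ofReal 2 by norm_num,
      ← ENNReal.ofReal_mul (by norm_num)]
    refine ENNReal.ofReal_le_ofReal ?_
    rw [div_div_eq_mul_div, div_one]
    nlinarith [show (0 : ℝ) < 5 ^ n * L by positivity]
  have hweak := (hT u hu h (hmemLp u
    (hwS.trans_lt (ENNReal.mul_lt_top (by simp) (ENNReal.mul_lt_top (by simp) hFtop))))).2
  have hchain : ENNReal.ofReal y * volume F ≤
      ENNReal.ofReal (6 * C * (32 * 5 ^ n) ^ k * L ^ k * l) * volume F := by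
    calc ENNReal.ofReal y * volume F
        ≤ ENNReal.ofReal y * weightMeasure u {x | y < ‖T h x‖} := by
          refine mul_le_mul_right (huF.trans (measure_mono (hFG.trans hGsub))) _
      _ ≤ C * a1Norm u ^ k * ∫⁻ x, ‖h x‖ₑ ∂(weightMeasure u) := by
          rw [← eLpNorm_one_eq_lintegral_enorm]
          exact (ofReal_mul_measure_le_weakL1Norm _ _ hy0).trans hweak
      _ ≤ C * ENNReal.ofReal (32 * 5 ^ n * L) ^ k *
            (ENNReal.ofReal l * (2 * (3 * volume F))) := by
          gcongr
          exact (lintegral_enorm_le_of_bounded _ hl).trans (mul_le_mul_right hwS _)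
      _ = ENNReal.ofReal (6 * C * (32 * 5 ^ n) ^ k * L ^ k * l) * volume F := by
          have e : 6 * (C : ℝ) * (32 * 5 ^ n) ^ k * L ^ k * l =
              C * (32 * 5 ^ n * L) ^ k * (l * 6) := by
            rw [mul_pow _ L]
            ring
          rw [e, ENNReal.ofReal_mul (p := C * (32 * 5 ^ n * L) ^ k) (by positivity),
            ENNReal.ofReal_mul (p := (C : ℝ)) (by positivity), ENNReal.ofReal_mul hl0,
            ENNReal.ofReal_coe_nnreal, ENNReal.ofReal_pow (by positivity),
            show ENNReal.ofReal 6 = 2 * 3 by norm_num]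
          ring
  rw [ENNReal.mul_le_mul_iff_left hF0 hFtop.ne, ENNReal.ofReal_le_ofReal_iff (by positivity)]
    at hchain
  linarith

/-! ### Decreasing rearrangements and their discretisation. -/

section Rearrangement

variable {α 𝕜 : Type*} [MeasureSpace α] [RCLike 𝕜] {f : α → 𝕜}

lemma rearr_le {t s : ℝ} (hs : 0 < s) (h : volume {x | s < ‖f x‖} ≤ ENNReal.ofReal t) :
    rearr f t ≤ ENNReal.ofReal s :=
  iInf_le_of_le s (iInf₂_le hs h)

lemma rearr_antitone (f : α → 𝕜) : Antitone (rearr f) := fun _ _ hab =>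
  le_iInf fun _ => le_iInf₂ fun hs h => rearr_le hs (h.trans (ENNReal.ofReal_le_ofReal hab))

/-- Right continuity of the distribution function gives the bound at the infimum itself, even when
the infimum is 0 and no admissible s > 0 attains it. -/
lemma volume_rearr_lt_norm_le {t : ℝ} (h : rearr f t ≠ ∞) :
    volume {x | (rearr f t).toReal < ‖f x‖} ≤ ENNReal.ofReal t := by
  refine measure_lt_norm_le_of_forall_gt fun y hy => ?_
  have hy' : rearr f t < ENNReal.ofReal y := (ENNReal.lt_ofReal_iff_toReal_lt h).2 hy
  simp only [rearr, iInf_lt_iff, exists_prop] at hy'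
  obtain ⟨s, hs, hst, hsy⟩ := hy'
  refine le_trans (measure_mono fun x hx => ?_) hst
  exact ((ENNReal.ofReal_lt_ofReal_iff_of_nonneg hs.le).1 hsy).trans hx

lemma rearr_ne_top_of_setLIntegral_ne_top {t : ℝ} (ht : 0 < t)
    (h : ∫⁻ s in Ioc 0 t, rearr f s ≠ ∞) {r : ℝ} (hr : 0 < r) : rearr f r ≠ ∞ := by
  intro hr'
  refine h (top_le_iff.1 ?_)
  have hm : 0 < min r t := lt_min hr ht
  calc (∞ : ℝ≥0∞) = ∫⁻ _ in Ioc 0 (min r t), ∞ := by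
        rw [setLIntegral_const, Real.volume_Ioc, ENNReal.top_mul]
        simpa using hm
    _ ≤ ∫⁻ s in Ioc 0 (min r t), rearr f s := setLIntegral_mono' measurableSet_Ioc fun s hs =>
        hr'.ge.trans (rearr_antitone f (hs.2.trans (min_le_left _ _)))
    _ ≤ ∫⁻ s in Ioc 0 t, rearr f s :=
        lintegral_mono_set (Ioc_subset_Ioc_right (min_le_right _ _))

lemma setLIntegral_enorm_le_setLIntegral_rearr (hf : AEStronglyMeasurable f volume) {t : ℝ}
    (ht : 0 < t) {E : Set α} (hE : volume E ≤ ENNReal.ofReal t) :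
    ∫⁻ x in E, ‖f x‖ₑ ≤ ∫⁻ s in Ioc 0 t, rearr f s := by
  by_cases htop : ∫⁻ s in Ioc 0 t, rearr f s = ∞
  · rw [htop]
    exact le_top
  have hfin := fun {r : ℝ} => rearr_ne_top_of_setLIntegral_ne_top (f := f) ht htop (r := r)
  calc ∫⁻ x in E, ‖f x‖ₑ
      = ∫⁻ x in E, ENNReal.ofReal ‖f x‖ := by simp_rw [ofReal_norm]
    _ = ∫⁻ y in Ioi (0 : ℝ), (volume.restrict E) {x | y < ‖f x‖} :=
        lintegral_eq_lintegral_meas_lt _ (Filter.Eventually.of_forall fun x => norm_nonneg _)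
          hf.norm.aemeasurable.restrict
    _ ≤ ∫⁻ y in Ioi (0 : ℝ), (volume.restrict (Ioc 0 t)) {r | y < (rearr f r).toReal} := by
        refine setLIntegral_mono' measurableSet_Ioi fun y hy => ?_
        have hy : 0 < y := hy
        set m := (volume.restrict E) {x | y < ‖f x‖} with hm
        have hmt : m ≤ ENNReal.ofReal t :=
          ((measure_mono (subset_univ _)).trans_eq
            (Measure.restrict_apply_univ E)).trans hE
        have hmtop : m ≠ ∞ := (hmt.trans_lt ENNReal.ofReal_lt_top).ne
        have hmv : m ≤ volume {x | y < ‖f x‖} := Measure.restrict_le_self _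
        -- If f^*(r) ≤ y then |{|f| > y}| ≤ r, impossible for r < m. So f^* exceeds y on an interval
        -- of length m.
        have hsub : Ioo 0 m.toReal ⊆ {r | y < (rearr f r).toReal} ∩ Ioc 0 t := by
          intro r hr
          refine ⟨?_, hr.1, hr.2.le.trans (ENNReal.toReal_le_of_le_ofReal ht.le hmt)⟩
          by_contra hle
          have h1 : volume {x | y < ‖f x‖} ≤ ENNReal.ofReal r :=
            (measure_mono fun x (hx : y < ‖f x‖) =>
              show (rearr f r).toReal < ‖f x‖ from (not_lt.1 hle).trans_lt hx).trans
              (volume_rearr_lt_norm_le (hfin hr.1))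
          have h2 : ENNReal.ofReal r < m := (ENNReal.ofReal_lt_iff_lt_toReal hr.1.le hmtop).2 hr.2
          exact absurd (h2.trans_le (hmv.trans h1)) (lt_irrefl _)
        calc m = volume (Ioo 0 m.toReal) := by simp [hmtop]
          _ ≤ volume ({r | y < (rearr f r).toReal} ∩ Ioc 0 t) := measure_mono hsub
          _ = _ := (Measure.restrict_apply' measurableSet_Ioc).symm
    _ = ∫⁻ s in Ioc 0 t, ENNReal.ofReal (rearr f s).toReal :=
        (lintegral_eq_lintegral_meas_lt _
          (Filter.Eventually.of_forall fun x => ENNReal.toReal_nonneg)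
          (rearr_antitone f).measurable.ennreal_toReal.aemeasurable).symm
    _ ≤ ∫⁻ s in Ioc 0 t, rearr f s := lintegral_mono fun s => ENNReal.ofReal_toReal_le

lemma rearr_le_average {t : ℝ} (ht : 0 < t) :
    rearr f t ≤ ENNReal.ofReal (1 / t) * ∫⁻ s in Ioc 0 t, rearr f s := by
  calc rearr f t = ENNReal.ofReal (1 / t) * ∫⁻ _ in Ioc 0 t, rearr f t := by
        rw [setLIntegral_const, Real.volume_Ioc, sub_zero, mul_left_comm,
          ← ENNReal.ofReal_mul (by positivity), one_div_mul_cancel ht.ne', ENNReal.ofReal_one,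
          mul_one]
    _ ≤ _ := mul_le_mul_right
        (setLIntegral_mono' measurableSet_Ioc fun s hs => rearr_antitone f hs.2) _

lemma setLIntegral_Ioc_const_div {a b c : ℝ} (ha : 0 < a) (hab : a ≤ b) (hc : 0 ≤ c) :
    ∫⁻ s in Ioc a b, ENNReal.ofReal (c / s) = ENNReal.ofReal (c * Real.log (b / a)) := by
  have h0 : (0 : ℝ) ∉ uIcc a b := by
    rw [uIcc_of_le hab]
    exact fun h => ha.not_ge h.1
  have hint : IntervalIntegrable (fun s : ℝ => c / s) volume a b := by
    simp_rw [div_eq_mul_inv]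
    exact (intervalIntegral.intervalIntegrable_inv (fun s hs => by
      rintro rfl
      exact h0 hs) continuousOn_id).const_mul c
  rw [intervalIntegrable_iff_integrableOn_Ioc_of_le hab] at hint
  rw [← ofReal_integral_eq_lintegral_ofReal hint, ← intervalIntegral.integral_of_le hab]
  · simp_rw [div_eq_mul_inv c]
    rw [intervalIntegral.integral_const_mul, integral_inv h0]
  · filter_upwards [ae_restrict_mem measurableSet_Ioc] with s hs
    exact div_nonneg hc (ha.trans hs.1).le

/-- Points at which `1 + log (s / t)` takes the values `2 ^ j`. -/
def expPoint (t : ℝ) (j : ℕ) : ℝ := t * Real.exp (2 ^ j - 1)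

lemma expPoint_zero (t : ℝ) : expPoint t 0 = t := by simp [expPoint]

lemma expPoint_pos {t : ℝ} (ht : 0 < t) (j : ℕ) : 0 < expPoint t j := by
  unfold expPoint
  positivity

lemma expPoint_monotone {t : ℝ} (ht : 0 < t) : Monotone (expPoint t) := by
  intro i j hij
  refine mul_le_mul_of_nonneg_left (Real.exp_le_exp.2 ?_) ht.le
  exact sub_le_sub_right (pow_le_pow_right₀ (by norm_num) hij) _

/-- On this interval 1 + log(s/t) ≥ 2^i, the measure ds/s has mass exactly 2^i, and f^* is smallest
at the right endpoint. The mass supplies the k-th factor 2^i. -/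
lemma rearr_expPoint_succ_le {t : ℝ} (ht : 0 < t) {k : ℕ} (hk : 1 ≤ k) (i : ℕ) :
    ENNReal.ofReal ((2 ^ i) ^ k) * rearr f (expPoint t (i + 1)) ≤
      ∫⁻ s in Ioc (expPoint t i) (expPoint t (i + 1)),
        ENNReal.ofReal ((1 + Real.log (s / t)) ^ (k - 1) / s) * rearr f s := by
  have hlog : Real.log (expPoint t (i + 1) / expPoint t i) = 2 ^ i := by
    rw [expPoint, expPoint, mul_div_mul_left _ _ ht.ne', ← Real.exp_sub, Real.log_exp]
    ring
  have hconst := setLIntegral_Ioc_const_div (c := (2 ^ i) ^ (k - 1)) (expPoint_pos ht i)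
    (expPoint_monotone ht (Nat.le_succ i)) (by positivity)
  rw [Nat.succ_eq_add_one, hlog, ← pow_succ, Nat.sub_add_cancel hk] at hconst
  rw [← hconst, ← lintegral_mul_const _ (by fun_prop)]
  refine setLIntegral_mono' measurableSet_Ioc fun s hs => ?_
  have hs0 : 0 < s := (expPoint_pos ht i).trans hs.1
  refine mul_le_mul' (ENNReal.ofReal_le_ofReal ?_) (rearr_antitone f hs.2)
  refine div_le_div_of_nonneg_right (pow_le_pow_left₀ (by positivity) ?_ _) hs0.le
  have h1 : Real.exp (2 ^ i - 1) ≤ s / t := by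
    rw [le_div_iff₀ ht, mul_comm]
    exact hs.1.le
  have := (Real.le_log_iff_exp_le (by positivity)).2 h1
  linarith

lemma sum_rearr_expPoint_le {t : ℝ} (ht : 0 < t) {k : ℕ} (hk : 1 ≤ k) (N : ℕ) :
    ∑ i ∈ Finset.range N, ENNReal.ofReal ((2 ^ i) ^ k) * rearr f (expPoint t (i + 1)) ≤
      ∫⁻ s in Ioi t, ENNReal.ofReal ((1 + Real.log (s / t)) ^ (k - 1) / s) * rearr f s := by
  refine (Finset.sum_le_sum fun i _ => rearr_expPoint_succ_le ht hk i).trans ?_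
  refine (ENNReal.sum_le_tsum _).trans ?_
  have hdisj : Pairwise (Function.onFun Disjoint fun i : ℕ =>
      Ioc (expPoint t i) (expPoint t (i + 1))) :=
    (expPoint_monotone ht).pairwise_disjoint_on_Ioc_succ
  rw [← lintegral_iUnion (fun i => measurableSet_Ioc) hdisj]
  refine lintegral_mono_set (iUnion_subset fun i s hs => ?_)
  exact ((expPoint_zero t).symm.le.trans (expPoint_monotone ht (Nat.zero_le i))).trans_lt hs.1

end Rearrangement

/-! ### Passing from weighted measure to Lebesgue measure. -/

lemma IsA1.aemeasurable_ofReal {n : ℕ} {u : (Fin n → ℝ) → ℝ} (hu : IsA1 u) :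
    AEMeasurable (fun x => ENNReal.ofReal (u x)) volume :=
  hu.locallyIntegrable.aestronglyMeasurable.aemeasurable.ennreal_ofReal

lemma IsA1.ofReal_ne_zero {n : ℕ} {u : (Fin n → ℝ) → ℝ} (hu : IsA1 u) :
    ∀ᵐ x, ENNReal.ofReal (u x) ≠ 0 := by
  filter_upwards [hu.pos] with x hx
  simpa using hx

lemma IsA1.absolutelyContinuous {n : ℕ} {u : (Fin n → ℝ) → ℝ} (hu : IsA1 u) :
    volume ≪ weightMeasure u :=
  withDensity_absolutelyContinuous' hu.aemeasurable_ofReal hu.ofReal_ne_zero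

lemma IsA1.a1Norm_ne_top {n : ℕ} {u : (Fin n → ℝ) → ℝ} (hu : IsA1 u) : a1Norm u ≠ ∞ := by
  obtain ⟨c, hc⟩ := hu.exists_bound
  exact ((a1Norm_le hc).trans_lt ENNReal.coe_lt_top).ne

/-- On sets of finite Lebesgue measure, convergence of weighted measures to zero implies
convergence of Lebesgue measures to zero. -/
lemma IsA1.tendsto_volume_inter {n : ℕ} {u : (Fin n → ℝ) → ℝ} (hu : IsA1 u)
    {B : Set (Fin n → ℝ)} (hB : MeasurableSet B) (hBtop : volume B ≠ ∞)
    {s : ℕ → Set (Fin n → ℝ)}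
    (hs : Filter.Tendsto (fun N => weightMeasure u (s N)) Filter.atTop (nhds 0)) :
    Filter.Tendsto (fun N => volume (s N ∩ B)) Filter.atTop (nhds 0) := by
  -- Lebesgue measure has density 1/u with respect to u dx, integrable over B because |B| < ∞;
  -- absolute continuity of the integral then gives the claim.
  have hvol : (weightMeasure u).withDensity (fun x => (ENNReal.ofReal (u x))⁻¹) = volume :=
    withDensity_inv_same₀ hu.aemeasurable_ofReal hu.ofReal_ne_zero
      (Filter.Eventually.of_forall fun x => ENNReal.ofReal_ne_top)
  have hW : SFinite (weightMeasure u) := by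
    unfold weightMeasure
    infer_instance
  have happ : ∀ A, volume A = ∫⁻ x in A, (ENNReal.ofReal (u x))⁻¹ ∂(weightMeasure u) := by
    intro A
    conv_lhs => rw [← hvol]
    exact withDensity_apply' _ _
  have h0 := tendsto_setLIntegral_zero (μ := (weightMeasure u).restrict B)
    (f := fun x => (ENNReal.ofReal (u x))⁻¹) (by rwa [← happ]) (s := s)
    (tendsto_of_tendsto_of_tendsto_of_le_of_le tendsto_const_nhds hs (fun _ => zero_le)
      fun N => Measure.restrict_le_self _)
  simp_rw [Measure.restrict_restrict' hB, ← happ] at h0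
  exact h0

lemma tendsto_weightMeasure_lt_norm_apply {n : ℕ} {𝕜 : Type*} [RCLike 𝕜] {k : ℕ} {C : ℝ≥0}
    {T : ((Fin n → ℝ) → 𝕜) → ((Fin n → ℝ) → 𝕜)} {u : (Fin n → ℝ) → ℝ} (hu : IsA1 u)
    (hT : BoundedL1WeakL1 T (weightMeasure u) ((C : ℝ≥0∞) * a1Norm u ^ k))
    {r : ℕ → (Fin n → ℝ) → 𝕜} (hr : ∀ N, MemLp (r N) 1 (weightMeasure u))
    (hlim : Filter.Tendsto (fun N => ∫⁻ x, ‖r N x‖ₑ ∂(weightMeasure u)) Filter.atTop (nhds 0))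
    {ε : ℝ} (hε : 0 < ε) :
    Filter.Tendsto (fun N => weightMeasure u {x | ε < ‖T (r N) x‖}) Filter.atTop (nhds 0) := by
  have hA : (C : ℝ≥0∞) * a1Norm u ^ k / ENNReal.ofReal ε ≠ ∞ :=
    ENNReal.div_ne_top (ENNReal.mul_ne_top ENNReal.coe_ne_top
      (ENNReal.pow_ne_top hu.a1Norm_ne_top)) (by simpa using hε)
  have h0 := ENNReal.Tendsto.const_mul hlim (Or.inr hA)
  rw [mul_zero] at h0
  refine tendsto_of_tendsto_of_tendsto_of_le_of_le tendsto_const_nhds h0 (fun _ => zero_le)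
    fun N => ?_
  have h1 := (ofReal_mul_measure_le_weakL1Norm _ (weightMeasure u) hε).trans (hT (r N) (hr N)).2
  rw [eLpNorm_one_eq_lintegral_enorm] at h1
  simp only
  rw [ENNReal.mul_comm_div, ← mul_div_assoc,
    ENNReal.le_div_iff_mul_le (Or.inl (by simpa using hε)) (Or.inl (by simp)), mul_comm]
  exact h1

/-! ### Cutting a function according to the size of its values. -/

section Cut

variable {α 𝕜 : Type*} [RCLike 𝕜] {f : α → 𝕜}

/-- The part of `f` on which `|f|` takes values in `I`. -/
def cut (f : α → 𝕜) (I : Set ℝ) : α → 𝕜 := {x | ‖f x‖ ∈ I}.indicator f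

lemma cut_of_mem {I : Set ℝ} {x : α} (h : ‖f x‖ ∈ I) : cut f I x = f x :=
  indicator_of_mem (s := {x | ‖f x‖ ∈ I}) h f

lemma cut_of_notMem {I : Set ℝ} {x : α} (h : ‖f x‖ ∉ I) : cut f I x = 0 :=
  indicator_of_notMem (s := {x | ‖f x‖ ∈ I}) h f

lemma cut_union {I J : Set ℝ} (h : Disjoint I J) : cut f (I ∪ J) = cut f I + cut f J := by
  ext x
  by_cases hI : ‖f x‖ ∈ I
  · rw [Pi.add_apply, cut_of_mem (Or.inl hI), cut_of_mem hI,
      cut_of_notMem (h.notMem_of_mem_left hI), add_zero]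
  · by_cases hJ : ‖f x‖ ∈ J
    · rw [Pi.add_apply, cut_of_mem (Or.inr hJ), cut_of_mem hJ, cut_of_notMem hI, zero_add]
    · rw [Pi.add_apply, cut_of_notMem (fun h => h.elim hI hJ), cut_of_notMem hI,
        cut_of_notMem hJ, add_zero]

lemma norm_cut_le (f : α → 𝕜) (I : Set ℝ) (x : α) : ‖cut f I x‖ ≤ ‖f x‖ :=
  norm_indicator_le_norm_self _ _

variable [MeasurableSpace α] {μ : Measure α}

lemma aestronglyMeasurable_cut (hf : AEStronglyMeasurable f μ) {I : Set ℝ}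
    (hI : MeasurableSet I) : AEStronglyMeasurable (cut f I) μ :=
  hf.indicator₀ (hf.norm.aemeasurable.nullMeasurableSet_preimage hI)

lemma memLp_cut (hf : MemLp f 1 μ) {I : Set ℝ} (hI : MeasurableSet I) : MemLp (cut f I) 1 μ :=
  hf.mono (aestronglyMeasurable_cut hf.1 hI) (Filter.Eventually.of_forall (norm_cut_le f I))

lemma tendsto_lintegral_enorm_cut_Iic (hf : MemLp f 1 μ) {l : ℕ → ℝ}
    (hl : Filter.Tendsto l Filter.atTop (nhds 0)) :
    Filter.Tendsto (fun N => ∫⁻ x, ‖cut f (Iic (l N)) x‖ₑ ∂μ) Filter.atTop (nhds 0) := by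
  have h := tendsto_lintegral_of_dominated_convergence' (μ := μ)
    (F := fun N x => ‖cut f (Iic (l N)) x‖ₑ) (f := fun _ => 0) (fun x => ‖f x‖ₑ)
    (fun N => (aestronglyMeasurable_cut hf.1 measurableSet_Iic).enorm)
    (fun N => Filter.Eventually.of_forall fun x => enorm_le_iff_norm_le.2 (norm_cut_le f _ x)) ?_
    (Filter.Eventually.of_forall fun x => ?_)
  · simpa using h
  · rw [← eLpNorm_one_eq_lintegral_enorm]
    exact hf.2.ne
  · refine tendsto_const_nhds.congr' ?_
    by_cases hx : f x = 0
    · refine Filter.Eventually.of_forall fun N => ?_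
      have := norm_cut_le f (Iic (l N)) x
      rw [hx, norm_zero, norm_le_zero_iff] at this
      simp [this]
    · filter_upwards [hl.eventually (gt_mem_nhds (norm_pos_iff.2 hx))] with N hN
      rw [cut_of_notMem (by simpa using hN), enorm_zero]

end Cut

/-! ### Summing the pieces. -/

lemma ae_norm_apply_le_sum {n : ℕ} {𝕜 : Type*} [RCLike 𝕜]
    {T : ((Fin n → ℝ) → 𝕜) → ((Fin n → ℝ) → 𝕜)} (hT : IsSublinearOn (a1Domain n 𝕜) T)
    {f : (Fin n → ℝ) → 𝕜} {u : (Fin n → ℝ) → ℝ} (hu : IsA1 u)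
    (hf : MemLp f 1 (weightMeasure u)) {l : ℕ → ℝ} (hl : Antitone l) (N : ℕ) :
    ∀ᵐ x, ‖T f x‖ ≤ ‖T (cut f (Ioi (l 0))) x‖ +
      (∑ j ∈ Finset.range N, ‖T (cut f (Ioc (l (j + 1)) (l j))) x‖ +
        ‖T (cut f (Iic (l N))) x‖) := by
  have hmem : ∀ I : Set ℝ, MeasurableSet I → cut f I ∈ a1Domain n 𝕜 := fun I hI =>
    ⟨u, hu, memLp_cut hf hI⟩
  induction N with
  | zero =>
    have h0 : f = cut f (Ioi (l 0)) + cut f (Iic (l 0)) := by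
      have hd : Disjoint (Ioi (l 0)) (Iic (l 0)) := (Iic_disjoint_Ioi le_rfl).symm
      rw [← cut_union hd, union_comm, Iic_union_Ioi]
      ext x
      rw [cut_of_mem (mem_univ _)]
    have := hT.1 _ (hmem _ (measurableSet_Ioi (a := l 0))) _
      (hmem _ (measurableSet_Iic (a := l 0)))
    rw [← h0] at this
    filter_upwards [this] with x hx
    simpa using hx
  | succ N ih =>
    have h0 : cut f (Iic (l N)) = cut f (Ioc (l (N + 1)) (l N)) + cut f (Iic (l (N + 1))) := by
      have hd : Disjoint (Ioc (l (N + 1)) (l N)) (Iic (l (N + 1))) :=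
        (Iic_disjoint_Ioc le_rfl).symm
      rw [← cut_union hd, union_comm, Iic_union_Ioc_eq_Iic (hl (Nat.le_succ N))]
    have := hT.1 _ (hmem _ (measurableSet_Ioc (a := l (N + 1)) (b := l N))) _
      (hmem _ (measurableSet_Iic (a := l (N + 1))))
    rw [← h0] at this
    filter_upwards [ih, this] with x hx hx'
    rw [Finset.sum_range_succ]
    linarith

/-- The left side is 2^{j+1} + (j + 2) log 2, and j + 2 ≤ 2^{j+1}. Hence the shrinking exceptional
sets t/2^{j+2} at most double the logarithm. -/
lemma one_add_log_expPoint_div_le {t : ℝ} (ht : 0 < t) (j : ℕ) :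
    1 + Real.log (expPoint t (j + 1) / (t / 2 ^ (j + 2))) ≤ 2 ^ (j + 2) := by
  have h1 : expPoint t (j + 1) / (t / 2 ^ (j + 2)) = Real.exp (2 ^ (j + 1) - 1) * 2 ^ (j + 2) := by
    rw [expPoint]
    field_simp
  have h2 : ((j + 2 : ℕ) : ℝ) ≤ 2 ^ (j + 1) := by
    exact_mod_cast Nat.lt_pow_self (n := j + 1) (a := 2) (by norm_num)
  rw [h1, Real.log_mul (Real.exp_pos _).ne' (by positivity), Real.log_exp, Real.log_pow]
  have h3 : Real.log 2 ≤ 1 := Real.log_two_lt_d9.le.trans (by norm_num)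
  have h4 : ((j + 2 : ℕ) : ℝ) * Real.log 2 ≤ ((j + 2 : ℕ) : ℝ) * 1 :=
    mul_le_mul_of_nonneg_left h3 (by positivity)
  have h5 : (2 : ℝ) ^ (j + 2) = 2 ^ (j + 1) + 2 ^ (j + 1) := by ring
  linarith

/-- The weak type bound with the constant weight, for functions in `L¹`. -/
lemma volume_lt_norm_apply_le_of_lintegral_le {n : ℕ} {𝕜 : Type*} [RCLike 𝕜] {k : ℕ} {C : ℝ≥0}
    {T : ((Fin n → ℝ) → 𝕜) → ((Fin n → ℝ) → 𝕜)}
    (hT : ∀ u : (Fin n → ℝ) → ℝ, IsA1 u →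
      BoundedL1WeakL1 T (weightMeasure u) ((C : ℝ≥0∞) * a1Norm u ^ k))
    {g : (Fin n → ℝ) → 𝕜} (hg : AEStronglyMeasurable g volume) {I τ : ℝ} (hI : 0 ≤ I)
    (hgI : ∫⁻ x, ‖g x‖ₑ ≤ ENNReal.ofReal I) (hτ : 0 < τ) :
    volume {x | C * I / τ < ‖T g x‖} ≤ ENNReal.ofReal τ := by
  refine measure_lt_norm_le_of_forall_gt fun y hy => ?_
  have hy0 : 0 < y := lt_of_le_of_lt (by positivity) hy
  have hgL : MemLp g 1 volume :=
    ⟨hg, by rw [eLpNorm_one_eq_lintegral_enorm]; exact hgI.trans_lt ENNReal.ofReal_lt_top⟩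
  have h1 := (hT _ isA1_one g (by rwa [weightMeasure_one])).2
  rw [weightMeasure_one, eLpNorm_one_eq_lintegral_enorm] at h1
  have h2 : ENNReal.ofReal y * volume {x | y < ‖T g x‖} ≤ ENNReal.ofReal y * ENNReal.ofReal τ := by
    calc ENNReal.ofReal y * volume {x | y < ‖T g x‖}
        ≤ (C : ℝ≥0∞) * a1Norm (n := n) (fun _ => 1) ^ k * ∫⁻ x, ‖g x‖ₑ :=
          (ofReal_mul_measure_le_weakL1Norm _ _ hy0).trans h1
      _ ≤ (C : ℝ≥0∞) * 1 ^ k * ENNReal.ofReal I := by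
          gcongr
          exact a1Norm_le a1Bound_one
      _ = ENNReal.ofReal (C * I) := by
          rw [one_pow, mul_one, ENNReal.ofReal_mul C.coe_nonneg, ENNReal.ofReal_coe_nnreal]
      _ ≤ ENNReal.ofReal (y * τ) :=
          ENNReal.ofReal_le_ofReal ((div_le_iff₀ hτ).1 (le_of_lt hy))
      _ = _ := ENNReal.ofReal_mul hy0.le
  exact (ENNReal.mul_le_mul_iff_right (by simpa using hy0) ENNReal.ofReal_ne_top).1 h2

lemma sum_div_two_pow_le {t : ℝ} (ht : 0 ≤ t) (N : ℕ) :
    ∑ j ∈ Finset.range N, t / 2 ^ (j + 2) ≤ t / 2 := by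
  have h : ∑ j ∈ Finset.range N, t / 2 ^ (j + 2) = t / 2 - t / 2 ^ (N + 1) := by
    induction N with
    | zero => simp
    | succ N ih =>
      rw [Finset.sum_range_succ, ih]
      field_simp
      ring
  rw [h]
  have : 0 ≤ t / 2 ^ (N + 1) := by positivity
  linarith

lemma sum_ofReal_div_two_pow_le {t : ℝ} (ht : 0 ≤ t) (N : ℕ) :
    ENNReal.ofReal (t / 4) + (∑ j ∈ Finset.range N, ENNReal.ofReal (t / 2 ^ (j + 2)) +
      ENNReal.ofReal (t / 4)) ≤ ENNReal.ofReal t := by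
  have h0 : ∀ j ∈ Finset.range N, 0 ≤ t / 2 ^ (j + 2) := fun j _ => by positivity
  have h4 : 0 ≤ t / 4 := by positivity
  rw [← ENNReal.ofReal_sum_of_nonneg h0, ← ENNReal.ofReal_add (Finset.sum_nonneg h0) h4,
    ← ENNReal.ofReal_add h4 (add_nonneg (Finset.sum_nonneg h0) h4)]
  refine ENNReal.ofReal_le_ofReal ?_
  have := sum_div_two_pow_le ht N
  linarith

/-- Where the sum exceeds the total of the thresholds, some summand exceeds its own. The set B stays
only with the remainder r, whose superlevel set is known to be small only locally. -/
lemma measure_lt_norm_le_of_sum {α 𝕜 : Type*} [MeasurableSpace α] [RCLike 𝕜] {μ : Measure α}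
    {F g r : α → 𝕜} {h : ℕ → α → 𝕜} {N : ℕ} {B : Set α}
    (hF : ∀ᵐ x ∂μ, ‖F x‖ ≤ ‖g x‖ + (∑ j ∈ Finset.range N, ‖h j x‖ + ‖r x‖))
    (y : ℝ) (z : ℕ → ℝ) (ε : ℝ) :
    μ ({x | y + (∑ j ∈ Finset.range N, z j + ε) < ‖F x‖} ∩ B) ≤
      μ {x | y < ‖g x‖} + (∑ j ∈ Finset.range N, μ {x | z j < ‖h j x‖} +
        μ ({x | ε < ‖r x‖} ∩ B)) := by
  have hsub : ({x | y + (∑ j ∈ Finset.range N, z j + ε) < ‖F x‖} ∩ B : Set α) ≤ᵐ[μ]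
      ({x | y < ‖g x‖} ∪ ((⋃ j ∈ Finset.range N, {x | z j < ‖h j x‖}) ∪
        ({x | ε < ‖r x‖} ∩ B)) : Set α) := by
    filter_upwards [hF] with x hx
    rintro ⟨hxF, hxB⟩
    have hxF : y + (∑ j ∈ Finset.range N, z j + ε) < ‖F x‖ := hxF
    by_contra hnot
    have hnot : x ∉ ({x | y < ‖g x‖} ∪ ((⋃ j ∈ Finset.range N, {x | z j < ‖h j x‖}) ∪
        ({x | ε < ‖r x‖} ∩ B)) : Set α) := hnot
    simp only [mem_union, mem_iUnion, mem_inter_iff, mem_ofPred_eq, not_or, not_exists, not_lt,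
      not_and] at hnot
    obtain ⟨h1, h2, h3⟩ := hnot
    have h4 : ∑ j ∈ Finset.range N, ‖h j x‖ ≤ ∑ j ∈ Finset.range N, z j :=
      Finset.sum_le_sum h2
    have h5 : ‖r x‖ ≤ ε := not_lt.1 fun h => h3 h hxB
    linarith
  refine (measure_mono_ae hsub).trans ((measure_union_le _ _).trans ?_)
  gcongr
  refine (measure_union_le _ _).trans ?_
  gcongr
  exact measure_biUnion_finset_le _ _

/-- A bound for `T f` above a level that controls all the pieces of `f`. -/
lemma rearr_apply_le_of_levels {n : ℕ} (hn : 1 ≤ n) {𝕜 : Type*} [RCLike 𝕜] {k : ℕ} {C : ℝ≥0}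
    {T : ((Fin n → ℝ) → 𝕜) → ((Fin n → ℝ) → 𝕜)} (hTsub : IsSublinearOn (a1Domain n 𝕜) T)
    (hT : ∀ u : (Fin n → ℝ) → ℝ, IsA1 u →
      BoundedL1WeakL1 T (weightMeasure u) ((C : ℝ≥0∞) * a1Norm u ^ k))
    {f : (Fin n → ℝ) → 𝕜} (hf : f ∈ a1Domain n 𝕜) {t : ℝ} (ht : 0 < t)
    (hI : ∫⁻ s in Ioc 0 t, rearr f s ≠ ∞)
    (hlim : Filter.Tendsto (fun j => (rearr f (expPoint t j)).toReal) Filter.atTop (nhds 0))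
    {Y : ℝ} (hY : ∀ N, C * (∫⁻ s in Ioc 0 t, rearr f s).toReal / (t / 4) +
      ∑ j ∈ Finset.range N, 6 * C * (32 * 5 ^ n) ^ k * (2 ^ (j + 2)) ^ k *
        (rearr f (expPoint t j)).toReal ≤ Y) :
    rearr (T f) t ≤ ENNReal.ofReal Y := by
  obtain ⟨u, hu, hfu⟩ := hf
  have hfm : AEStronglyMeasurable f volume := hfu.1.mono_ac hu.absolutelyContinuous
  have hfin : ∀ j, rearr f (expPoint t j) ≠ ∞ := fun j =>
    rearr_ne_top_of_setLIntegral_ne_top ht hI (expPoint_pos ht j)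
  set I := ∫⁻ s in Ioc 0 t, rearr f s
  set l : ℕ → ℝ := fun j => (rearr f (expPoint t j)).toReal
  have hl0 : ∀ j, 0 ≤ l j := fun j => ENNReal.toReal_nonneg
  have hl : Antitone l := fun i j hij =>
    ENNReal.toReal_mono (hfin i) (rearr_antitone f (expPoint_monotone ht hij))
  have hlev : ∀ j, volume {x | l j < ‖f x‖} ≤ ENNReal.ofReal (expPoint t j) := fun j =>
    volume_rearr_lt_norm_le (hfin j)
  have hY0 : 0 ≤ Y := le_trans (by positivity) (hY 0)
  refine ENNReal.le_of_forall_pos_le_add fun ε hε _ => ?_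
  have hε' : (0 : ℝ) < ε := hε
  rw [← ENNReal.ofReal_coe_nnreal, ← ENNReal.ofReal_add hY0 hε'.le]
  refine rearr_le (by positivity) ?_
  have hfirst : volume {x | C * I.toReal / (t / 4) < ‖T (cut f (Ioi (l 0))) x‖} ≤
      ENNReal.ofReal (t / 4) := by
    refine volume_lt_norm_apply_le_of_lintegral_le hT
      (aestronglyMeasurable_cut hfm measurableSet_Ioi) ENNReal.toReal_nonneg ?_ (by positivity)
    rw [ENNReal.ofReal_toReal hI]
    refine le_trans (le_of_eq ?_) (setLIntegral_enorm_le_setLIntegral_rearr hfm ht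
      (E := {x | ‖f x‖ ∈ Ioi (l 0)}) ?_)
    · have hnull : NullMeasurableSet {x | ‖f x‖ ∈ Ioi (l 0)} volume :=
        hfm.norm.aemeasurable.nullMeasurableSet_preimage measurableSet_Ioi
      rw [← lintegral_indicator₀ hnull]
      simp_rw [cut, enorm_indicator_eq_indicator_enorm]
    · have := hlev 0
      rwa [expPoint_zero] at this
  have hmiddle : ∀ j, volume {x | 6 * C * (32 * 5 ^ n) ^ k * (2 ^ (j + 2)) ^ k * l j <
      ‖T (cut f (Ioc (l (j + 1)) (l j))) x‖} ≤ ENNReal.ofReal (t / 2 ^ (j + 2)) := by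
    intro j
    have hτs : t / 2 ^ (j + 2) ≤ expPoint t (j + 1) := by
      refine (div_le_self ht.le (one_le_pow₀ (by norm_num))).trans ?_
      calc t = expPoint t 0 := (expPoint_zero t).symm
        _ ≤ _ := expPoint_monotone ht (Nat.zero_le _)
    have hτ0 : 0 < t / 2 ^ (j + 2) := by positivity
    have hlog := Real.log_nonneg ((one_le_div hτ0).2 hτs)
    have hcut : ∀ x, ‖cut f (Ioc (l (j + 1)) (l j)) x‖ ≤ l j := fun x => by
      by_cases hx : ‖f x‖ ∈ Ioc (l (j + 1)) (l j)
      · rw [cut_of_mem hx]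
        exact hx.2
      · rw [cut_of_notMem hx, norm_zero]
        exact hl0 j
    have hsupp : volume (Function.support (cut f (Ioc (l (j + 1)) (l j)))) ≤
        ENNReal.ofReal (expPoint t (j + 1)) := by
      refine (measure_mono fun x hx => ?_).trans (hlev (j + 1))
      by_contra hx'
      exact hx (cut_of_notMem fun h => hx' h.1)
    refine le_trans (measure_mono fun x (hx : 6 * C * (32 * 5 ^ n) ^ k * (2 ^ (j + 2)) ^ k * l j <
      ‖T (cut f (Ioc (l (j + 1)) (l j))) x‖) => ?_) (volume_lt_norm_apply_le hn hT
      (aestronglyMeasurable_cut hfm measurableSet_Ioc) (hl0 j) hcut hτ0 hτs hsupp)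
    refine lt_of_le_of_lt ?_ hx
    have := pow_le_pow_left₀ (by linarith) (one_add_log_expPoint_div_le ht j) k
    gcongr
  have htail := tendsto_weightMeasure_lt_norm_apply hu (hT u hu)
    (fun N => memLp_cut hfu (measurableSet_Iic (a := l N)))
    (tendsto_lintegral_enorm_cut_Iic hfu hlim) hε'
  -- The number N of pieces depends on the ball, but Y bounds the thresholds for every N, so the
  -- ball can afterwards grow to the whole space.
  have hball : ∀ m : ℕ, volume ({x | Y + ε < ‖T f x‖} ∩ Metric.closedBall 0 (m : ℝ)) ≤
      ENNReal.ofReal t := by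
    intro m
    have hlocal := hu.tendsto_volume_inter (B := Metric.closedBall 0 (m : ℝ))
      measurableSet_closedBall measure_closedBall_lt_top.ne htail
    have ht4 : 0 < ENNReal.ofReal (t / 4) := by
      rw [ENNReal.ofReal_pos]
      positivity
    obtain ⟨N, hN⟩ := (hlocal.eventually (gt_mem_nhds ht4)).exists
    have hsum := measure_lt_norm_le_of_sum (B := Metric.closedBall 0 (m : ℝ))
      (ae_norm_apply_le_sum hTsub hu hfu hl N) (C * I.toReal / (t / 4))
      (fun j => 6 * C * (32 * 5 ^ n) ^ k * (2 ^ (j + 2)) ^ k * l j) ε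
    calc volume ({x | Y + ε < ‖T f x‖} ∩ Metric.closedBall 0 (m : ℝ))
        ≤ _ := measure_mono (inter_subset_inter_left _ fun x (hx : Y + ε < ‖T f x‖) =>
            lt_of_le_of_lt (by have := hY N; linarith) hx)
      _ ≤ _ := hsum
      _ ≤ ENNReal.ofReal (t / 4) + (∑ j ∈ Finset.range N, ENNReal.ofReal (t / 2 ^ (j + 2)) +
          ENNReal.ofReal (t / 4)) :=
          add_le_add hfirst (add_le_add (Finset.sum_le_sum fun j _ => hmiddle j) hN.le)
      _ ≤ ENNReal.ofReal t := sum_ofReal_div_two_pow_le ht.le N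
  have hmono : Monotone fun m : ℕ => {x | Y + ε < ‖T f x‖} ∩ Metric.closedBall 0 (m : ℝ) :=
    fun i j hij => inter_subset_inter_right _ (Metric.closedBall_subset_closedBall
      (by exact_mod_cast hij))
  calc volume {x | Y + ε < ‖T f x‖}
      = volume (⋃ m : ℕ, {x | Y + ε < ‖T f x‖} ∩ Metric.closedBall 0 (m : ℝ)) := by
        rw [← inter_iUnion, Metric.iUnion_closedBall_nat, inter_univ]
    _ ≤ ENNReal.ofReal t := by
        rw [hmono.measure_iUnion]
        exact iSup_le hball

/-- Each term (2^i)^k f^*(t_{i+1}) is at most J < ∞, and k ≥ 1 gives geometric decay. -/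
lemma tendsto_rearr_expPoint {α 𝕜 : Type*} [MeasureSpace α] [RCLike 𝕜] {f : α → 𝕜} {t : ℝ}
    (ht : 0 < t) {k : ℕ} (hk : 1 ≤ k)
    (hJ : ∫⁻ s in Ioi t,
      ENNReal.ofReal ((1 + Real.log (s / t)) ^ (k - 1) / s) * rearr f s ≠ ∞) :
    Filter.Tendsto (fun j => (rearr f (expPoint t j)).toReal) Filter.atTop (nhds 0) := by
  set J := ∫⁻ s in Ioi t,
    ENNReal.ofReal ((1 + Real.log (s / t)) ^ (k - 1) / s) * rearr f s
  rw [← Filter.tendsto_add_atTop_iff_nat 1]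
  have hgeo : Filter.Tendsto (fun i : ℕ => J.toReal * (1 / 2) ^ i) Filter.atTop (nhds 0) := by
    simpa using (tendsto_pow_atTop_nhds_zero_of_lt_one (r := (1 / 2 : ℝ)) (by norm_num)
      (by norm_num)).const_mul J.toReal
  refine tendsto_of_tendsto_of_tendsto_of_le_of_le tendsto_const_nhds hgeo
    (fun _ => ENNReal.toReal_nonneg) fun i => ?_
  have h1 : ENNReal.ofReal ((2 ^ i) ^ k) * rearr f (expPoint t (i + 1)) ≤ J :=
    (Finset.single_le_sum (f := fun i => ENNReal.ofReal ((2 ^ i) ^ k) *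
      rearr f (expPoint t (i + 1))) (fun _ _ => zero_le) (Finset.self_mem_range_succ i)).trans
      (sum_rearr_expPoint_le ht hk (i + 1))
  have h2 := ENNReal.toReal_mono hJ h1
  rw [ENNReal.toReal_mul, ENNReal.toReal_ofReal (by positivity)] at h2
  have h3 : (2 : ℝ) ^ i ≤ (2 ^ i) ^ k := le_self_pow₀ (one_le_pow₀ (by norm_num)) (by omega)
  simp only
  rw [one_div, inv_pow, ← div_eq_mul_inv, le_div_iff₀ (by positivity), mul_comm]
  exact (mul_le_mul_of_nonneg_right h3 ENNReal.toReal_nonneg).trans h2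

end WeakRearr

end

/-! ### The main estimate and its constant. -/

open WeakRearr in
theorem theorem1p1 {𝕜 : Type*} [RCLike 𝕜] (n : ℕ) (hn : 1 ≤ n) (k : ℕ) (hk : 1 ≤ k) (C : ℝ≥0) :
    ∃ K : ℝ≥0, ∀ T : ((Fin n → ℝ) → 𝕜) → ((Fin n → ℝ) → 𝕜),
      WeakRearr.IsSublinearOn (WeakRearr.a1Domain n 𝕜) T →
      (∀ u : (Fin n → ℝ) → ℝ, WeakRearr.IsA1 u →
        WeakRearr.BoundedL1WeakL1 T (WeakRearr.weightMeasure u)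
          ((C : ℝ≥0∞) * WeakRearr.a1Norm u ^ k)) →
      ∀ f ∈ WeakRearr.a1Domain n 𝕜, ∀ t : ℝ, 0 < t →
        WeakRearr.rearr (T f) t ≤
          (K : ℝ≥0∞) *
            (ENNReal.ofReal (1 / t) * (∫⁻ s in Set.Ioc 0 t, WeakRearr.rearr f s) +
              ∫⁻ s in Set.Ioi t,
                ENNReal.ofReal ((1 + Real.log (s / t)) ^ (k - 1) / s) * WeakRearr.rearr f s) := by
  -- The factor 8^k comes from the reindexing j = i + 1, under which 2^{j+2} = 8·2^i. In K, 4C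
  -- accounts for the part of f above f^*(t), and the summand 1 keeps K nonzero when C = 0, so that
  -- an infinite right side stays infinite.
  set D : ℝ≥0 := 6 * C * (32 * 5 ^ n) ^ k * 8 ^ k with hD
  refine ⟨4 * C + D + 1, fun T hTsub hT f hf t ht => ?_⟩
  set I := ∫⁻ s in Set.Ioc 0 t, rearr f s
  set J := ∫⁻ s in Set.Ioi t,
    ENNReal.ofReal ((1 + Real.log (s / t)) ^ (k - 1) / s) * rearr f s
  have hK0 : ((4 * C + D + 1 : ℝ≥0) : ℝ≥0∞) ≠ 0 := by
    rw [ENNReal.coe_ne_zero]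
    positivity
  have ht0 : ENNReal.ofReal (1 / t) ≠ 0 := by
    rw [Ne, ENNReal.ofReal_eq_zero, not_le]
    positivity
  by_cases hI : I = ∞
  · rw [hI, ENNReal.mul_top ht0, top_add, ENNReal.mul_top hK0]
    exact le_top
  by_cases hJ : J = ∞
  · rw [hJ, add_top, ENNReal.mul_top hK0]
    exact le_top
  have hRtop : ((4 * C + D + 1 : ℝ≥0) : ℝ≥0∞) * (ENNReal.ofReal (1 / t) * I + J) ≠ ∞ :=
    ENNReal.mul_ne_top ENNReal.coe_ne_top
      (ENNReal.add_ne_top.2 ⟨ENNReal.mul_ne_top ENNReal.ofReal_ne_top hI, hJ⟩)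
  rw [← ENNReal.ofReal_toReal hRtop]
  refine rearr_apply_le_of_levels hn hTsub hT hf ht hI (tendsto_rearr_expPoint ht hk hJ)
    fun N => ?_
  have hfin : ∀ j, rearr f (expPoint t j) ≠ ∞ := fun j =>
    rearr_ne_top_of_setLIntegral_ne_top ht hI (expPoint_pos ht j)
  have h0 : (rearr f (expPoint t 0)).toReal ≤ 1 / t * I.toReal := by
    rw [expPoint_zero]
    have h := ENNReal.toReal_mono (ENNReal.mul_ne_top ENNReal.ofReal_ne_top hI)
      (rearr_le_average (f := f) ht)
    rwa [ENNReal.toReal_mul, ENNReal.toReal_ofReal (by positivity)] at h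
  have hsum : ∑ i ∈ Finset.range N, (2 ^ i) ^ k * (rearr f (expPoint t (i + 1))).toReal ≤
      J.toReal := by
    have h := ENNReal.toReal_mono hJ (sum_rearr_expPoint_le (f := f) ht hk N)
    rw [ENNReal.toReal_sum fun i _ => ENNReal.mul_ne_top ENNReal.ofReal_ne_top (hfin _)] at h
    refine le_of_eq_of_le (Finset.sum_congr rfl fun i _ => ?_) h
    rw [ENNReal.toReal_mul, ENNReal.toReal_ofReal (by positivity)]
  have hpieces : ∑ j ∈ Finset.range N, 6 * C * (32 * 5 ^ n) ^ k * (2 ^ (j + 2)) ^ k *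
      (rearr f (expPoint t j)).toReal ≤ D * (1 / t * I.toReal + J.toReal) := by
    have hterm : ∀ j, 0 ≤ 6 * (C : ℝ) * (32 * 5 ^ n) ^ k * (2 ^ (j + 2)) ^ k *
      (rearr f (expPoint t j)).toReal := fun j => by positivity
    -- One more nonnegative term is added so that j = 0 can be split off even for N = 0; it is
    -- controlled by the average, the others by J.
    refine (Finset.sum_le_sum_of_subset_of_nonneg (Finset.range_mono (Nat.le_succ N))
      fun j _ _ => hterm j).trans ?_
    rw [Nat.succ_eq_add_one, Finset.sum_range_succ', mul_add, add_comm]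
    have hDr : (D : ℝ) = 6 * C * (32 * 5 ^ n) ^ k * 8 ^ k := by
      rw [hD]
      push_cast
      ring
    refine add_le_add ?_ ?_
    · rw [hDr]
      have h48 : ((2 : ℝ) ^ (0 + 2)) ^ k ≤ 8 ^ k := pow_le_pow_left₀ (by norm_num) (by norm_num) k
      exact mul_le_mul (by gcongr) h0 ENNReal.toReal_nonneg (by positivity)
    · refine le_trans (le_of_eq ?_) (mul_le_mul_of_nonneg_left hsum D.2)
      rw [Finset.mul_sum]
      refine Finset.sum_congr rfl fun i _ => ?_
      change _ = (D : ℝ) * _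
      rw [hDr, show (2 : ℝ) ^ (i + 1 + 2) = 8 * 2 ^ i by ring, mul_pow 8]
      ring
  have hR : (((4 * C + D + 1 : ℝ≥0) : ℝ≥0∞) * (ENNReal.ofReal (1 / t) * I + J)).toReal =
      (4 * C + D + 1) * (1 / t * I.toReal + J.toReal) := by
    rw [ENNReal.toReal_mul, ENNReal.toReal_add (ENNReal.mul_ne_top ENNReal.ofReal_ne_top hI) hJ,
      ENNReal.toReal_mul, ENNReal.toReal_ofReal (by positivity), ENNReal.coe_toReal]
    push_cast
    rfl
  rw [hR]
  have hI0 : 0 ≤ 1 / t * I.toReal := by positivity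
  have hJ0 : 0 ≤ J.toReal := ENNReal.toReal_nonneg
  have hfirst : C * I.toReal / (t / 4) = 4 * C * (1 / t * I.toReal) := by
    field_simp
  rw [hfirst]
  have : 0 ≤ (C : ℝ) * J.toReal := by positivity
  nlinarith
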